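/- Let $H$ and $U$ be (real or complex) Hilbert spaces, let $A:\mathcal D(A)\subset H\to H$ be a self-adjoint, positive and boundedly invertible operator, and let $B:U\to H$ be a bounded linear operator. Write $H_1=\mathcal D(A)$ with norm $\|x\|_{H_1}=\|Ax\|_H$, $H_{1/2}=\mathcal D(A^{1/2})$ with norm $\|x\|_{H_{1/2}}=\|A^{1/2}x\|_H$, and $$\|(x,y)\|^2_{H_1\times H_{1/2}}=\|Ax\|_H^2+\|A^{1/2}y\|_H^2,\qquad \|(x,y)\|^2_{H_{1/2}\times H}=\|A^{1/2}x\|_H^2+\|y\|_H^2 .$$ Let $\mathcal H:(0,\infty)\to(0,\infty)$ be continuous and strictly increasing, with inverse $\mathcal H^{-1}$ defined on the range of $\mathcal H$, and suppose that $x\mapsto \mathcal H(x)/x$ is (not necessarily strictly) increasing on $(0,1)$. For a bounded operator $D$ on $H$ and data $(w_0,w_1)\in H_1\times H_{1/2}$, the strong solution of $\ddot w+Aw+D\dot w=0$, $w(0)=w_0$, $\dot w(0)=w_1$, is the function $w\in C([0,\infty);H_1)\cap C^1([0,\infty);H_{1/2})\cap C^2([0,\infty);H)$ that satisfies the initial conditions,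 and the equation in $H$ for all $t\ge 0$. Suppose that there are constants $T>0$ and $C>0$ such that for every $(\varphi_0,\varphi_1)\in H_1\times H_{1/2}$ with $(\varphi_0,\varphi_1)\neq(0,0)$, the strong solution $\varphi$ of $\ddot\varphi+A\varphi=0$, $\varphi(0)=\varphi_0$, $\dot\varphi(0)=\varphi_1$, satisfies $$\int_0^T\|B^*\dot\varphi(t)\|_U^2\,dt\;\ge\; C\,\|(\varphi_0,\varphi_1)\|^2_{H_1\times H_{1/2}}\;\mathcal H\!\left(\frac{\|(\varphi_0,\varphi_1)\|^2_{H_{1/2}\times H}}{\|(\varphi_0,\varphi_1)\|^2_{H_1\times H_{1/2}}}\right).$$ Then there is a constant $C_1>0$ such that for every $(w_0,w_1)\in H_1\times H_{1/2}$ with $(w_0,w_1)\neq(0,0)$, the strong solution $w$ of $\ddot w+Aw+BB^*\dot w=0$, $w(0)=w_0$, $\dot w(0)=w_1$, satisfies $$\|(w(t),\dot w(t))\|^2_{H_{1/2}\times H}\;\le\; C_1\,\mathcal H^{-1}\!\left(\frac1{1+t}\right)\|(w_0,w_1)\|^2_{H_1\times H_{1/2}}$$ for every $t>0$ such that $\frac1{1+t}$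 lies in the range of $\mathcal H$ (for every $t>0$, if $\mathcal H$ maps onto $(0,\infty)$). -/

import Mathlib

open Set MeasureTheory
open scoped InnerProductSpace

noncomputable section

namespace WeakStab

variable {𝕜 H U : Type*} [RCLike 𝕜]
  [NormedAddCommGroup H] [InnerProductSpace 𝕜 H] [CompleteSpace H]
  [NormedAddCommGroup U] [InnerProductSpace 𝕜 U] [CompleteSpace U]

/-- `A : D(A) ⊂ H → H` is self-adjoint, positive and boundedly invertible. Self-adjointness is
equality with the Hilbert space adjoint, domains included (it entails that `D(A)` is dense). -/
structure IsPosInvertible (A : H →ₗ.[𝕜] H) : Prop where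
  selfAdjoint : IsSelfAdjoint A
  nonneg : ∀ x : A.domain, 0 ≤ RCLike.re ⟪A x, (x : H)⟫_𝕜
  invertible : ∃ R : H →L[𝕜] H,
    (∀ x : A.domain, R (A x) = x) ∧ ∀ y : H, ∃ h : R y ∈ A.domain, A ⟨R y, h⟩ = y

/-- `S` is a positive self-adjoint square root of `A`: `S` is self-adjoint and nonnegative, and
`S ∘ S = A` as unbounded operators (equality of graphs, hence of domains and of values). -/
structure IsPosSqrt (A S : H →ₗ.[𝕜] H) : Prop where
  selfAdjoint : IsSelfAdjoint S
  nonneg : ∀ x : S.domain, 0 ≤ RCLike.re ⟪S x, (x : H)⟫_𝕜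
  sq : ∀ x y : H, (x, y) ∈ A.graph ↔ ∃ z : H, (x, z) ∈ S.graph ∧ (z, y) ∈ S.graph

/-! ### Existence of the square root -/

/-- The scalar iteration `y ↦ (1 + y²) / 2` started at `0`. -/
def scalarIter : ℕ → ℝ
  | 0 => 0
  | n + 1 => (1 + scalarIter n ^ 2) / 2

/-- The operator iteration `Y ↦ (X + Y²) / 2` started at `0`. -/
def opIter (X : H →L[𝕜] H) : ℕ → (H →L[𝕜] H)
  | 0 => 0
  | n + 1 => (2⁻¹ : 𝕜) • (X + opIter X n * opIter X n)

theorem scalarIter_bounds (n : ℕ) :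
    0 ≤ scalarIter n ∧ scalarIter n ≤ 1 ∧ scalarIter n ≤ scalarIter (n + 1) := by
  have h : ∀ n, 0 ≤ scalarIter n ∧ scalarIter n ≤ 1 := by
    intro n
    induction n with
    | zero => simp [scalarIter]
    | succ n ih =>
      simp only [scalarIter]
      constructor
      · positivity
      · nlinarith [ih.1, ih.2]
  refine ⟨(h n).1, (h n).2, ?_⟩
  simp only [scalarIter]
  nlinarith [sq_nonneg (scalarIter n - 1)]

theorem exists_sqrt_of_norm_le (X : H →L[𝕜] H) (hX : IsSelfAdjoint X) (h1 : ‖X‖ ≤ 1) :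
    ∃ Y : H →L[𝕜] H, IsSelfAdjoint Y ∧ ‖Y‖ ≤ 1 ∧ (1 - Y) * (1 - Y) = 1 - X := by
  have hn2 : ‖(2⁻¹ : 𝕜)‖ = 2⁻¹ := by simp
  have hsa : ∀ n, IsSelfAdjoint (opIter X n) := by
    intro n
    induction n with
    | zero => exact IsSelfAdjoint.zero _
    | succ n ih =>
      have h2 : IsSelfAdjoint (opIter X n * opIter X n) := by
        rw [IsSelfAdjoint, star_mul, ih.star_eq]
      have h3 : IsSelfAdjoint (2⁻¹ : 𝕜) := by simp [IsSelfAdjoint]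
      exact h3.smul (hX.add h2)
  have hcX : ∀ n, Commute X (opIter X n) := by
    intro n
    induction n with
    | zero => exact Commute.zero_right _
    | succ n ih => exact ((Commute.refl X).add_right (ih.mul_right ih)).smul_right _
  have hcc : ∀ n m, Commute (opIter X n) (opIter X m) := by
    intro n m
    induction m with
    | zero => exact Commute.zero_right _
    | succ m ih => exact (((hcX n).symm).add_right (ih.mul_right ih)).smul_right _
  have hnorm : ∀ n, ‖opIter X n‖ ≤ scalarIter n := by
    intro n
    induction n with
    | zero => simp [opIter, scalarIter]
    | succ n ih =>
      simp only [opIter, scalarIter]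
      rw [norm_smul, hn2]
      have h2 := norm_add_le X (opIter X n * opIter X n)
      have h3 := norm_mul_le (opIter X n) (opIter X n)
      nlinarith [norm_nonneg (opIter X n)]
  have hdiff : ∀ n, ‖opIter X (n + 1) - opIter X n‖ ≤ scalarIter (n + 1) - scalarIter n := by
    intro n
    induction n with
    | zero => simpa [opIter, scalarIter] using hnorm 1
    | succ n ih =>
      have e : opIter X (n + 1 + 1) - opIter X (n + 1) = (2⁻¹ : 𝕜) •
          ((opIter X (n + 1) - opIter X n) * (opIter X (n + 1) + opIter X n)) := by
        have hc := (hcc n (n + 1)).eq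
        have e1 : opIter X (n + 1 + 1) =
          (2⁻¹ : 𝕜) • (X + opIter X (n + 1) * opIter X (n + 1)) := rfl
        have e2 : opIter X (n + 1) = (2⁻¹ : 𝕜) • (X + opIter X n * opIter X n) := rfl
        rw [e1]
        conv_lhs => rw [sub_eq_add_neg]; rhs; rw [e2]
        rw [← sub_eq_add_neg, ← smul_sub]
        congr 1
        rw [sub_mul, mul_add, mul_add, hc]
        abel
      rw [e, norm_smul, hn2]
      have h2 := norm_mul_le (opIter X (n + 1) - opIter X n) (opIter X (n + 1) + opIter X n)
      have h3 := norm_add_le (opIter X (n + 1)) (opIter X n)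
      have h4 := hnorm n
      have h5 := hnorm (n + 1)
      have e3 : scalarIter (n + 1 + 1) - scalarIter (n + 1) = 2⁻¹ *
          ((scalarIter (n + 1) - scalarIter n) * (scalarIter (n + 1) + scalarIter n)) := by
        have e1 : scalarIter (n + 1 + 1) = (1 + scalarIter (n + 1) ^ 2) / 2 := rfl
        have e2 : scalarIter (n + 1) = (1 + scalarIter n ^ 2) / 2 := rfl
        rw [e1]
        conv_lhs => rw [sub_eq_add_neg]; rhs; rw [e2]
        ring
      rw [e3]
      refine mul_le_mul_of_nonneg_left (h2.trans ?_) (by norm_num)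
      exact mul_le_mul ih (h3.trans (add_le_add h5 h4)) (norm_nonneg _)
        ((norm_nonneg _).trans ih)
  have hcau : CauchySeq (opIter X) := by
    have hs : Summable fun n => scalarIter (n + 1) - scalarIter n := by
      refine summable_of_sum_range_le (c := 1) (fun n => ?_) fun n => ?_
      · exact sub_nonneg.2 (scalarIter_bounds n).2.2
      · rw [Finset.sum_range_sub]
        simpa [scalarIter] using (scalarIter_bounds n).2.1
    refine cauchySeq_of_summable_dist (Summable.of_nonneg_of_le (fun _ => dist_nonneg)
      (fun n => ?_) hs)
    rw [dist_comm, dist_eq_norm]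
    exact hdiff n
  obtain ⟨Y, hY⟩ := cauchySeq_tendsto_of_complete hcau
  refine ⟨Y, ?_, ?_, ?_⟩
  · have h2 := (continuous_star.tendsto Y).comp hY
    refine tendsto_nhds_unique h2 (hY.congr fun n => ?_)
    exact ((hsa n).star_eq).symm
  · refine le_of_tendsto hY.norm (Filter.Eventually.of_forall fun n => ?_)
    exact (hnorm n).trans (scalarIter_bounds n).2.1
  · have h2 : Filter.Tendsto (fun n => opIter X (n + 1)) Filter.atTop
        (nhds ((2⁻¹ : 𝕜) • (X + Y * Y))) :=
      (tendsto_const_nhds.add (hY.mul hY)).const_smul _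
    have h3 := tendsto_nhds_unique ((Filter.tendsto_add_atTop_iff_nat 1).2 hY) h2
    have h4 : Y + Y = X + Y * Y := by
      have h5 : (2 : 𝕜) • Y = X + Y * Y := by
        conv_lhs => rw [h3]
        rw [smul_smul]
        norm_num
      rw [← h5, two_smul]
    have h6 : (1 - Y) * (1 - Y) = 1 - (Y + Y) + Y * Y := by
      rw [sub_mul, mul_sub, mul_sub]
      simp only [one_mul, mul_one]
      abel
    rw [h6, h4]
    abel

/-- A bounded positive operator has a bounded positive square root. -/
theorem exists_bounded_sqrt (R : H →L[𝕜] H) (hR : R.IsPositive) :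
    ∃ Q : H →L[𝕜] H, Q.IsPositive ∧ Q * Q = R := by
  rcases eq_or_ne R 0 with rfl | hne
  · exact ⟨0, ContinuousLinearMap.isPositive_zero, by simp⟩
  have hc : 0 < ‖R‖ := norm_pos_iff.2 hne
  set c := ‖R‖ with hcdef
  have hkey : ∀ x, ‖R x‖ ^ 2 ≤ c * RCLike.re ⟪R x, x⟫_𝕜 := by
    intro x
    have h1 := hR.re_inner_nonneg_left (x - ((c⁻¹ : ℝ) : 𝕜) • R x)
    have h2 : RCLike.re ⟪R (R x), R x⟫_𝕜 ≤ c * ‖R x‖ ^ 2 := by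
      have h3 := re_inner_le_norm (𝕜 := 𝕜) (R (R x)) (R x)
      have h4 := R.le_opNorm (R x)
      nlinarith [norm_nonneg (R x)]
    have h5 : RCLike.re ⟪R (x - ((c⁻¹ : ℝ) : 𝕜) • R x), x - ((c⁻¹ : ℝ) : 𝕜) • R x⟫_𝕜 =
        RCLike.re ⟪R x, x⟫_𝕜 - 2 * c⁻¹ * ‖R x‖ ^ 2
          + c⁻¹ ^ 2 * RCLike.re ⟪R (R x), R x⟫_𝕜 := by
      rw [map_sub, map_smul, inner_sub_left, inner_sub_right, inner_sub_right, inner_smul_left,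
        inner_smul_left, inner_smul_right, inner_smul_right,
        hR.inner_left_eq_inner_right (R x) x, RCLike.conj_ofReal, inner_self_eq_norm_sq_to_K]
      simp only [map_sub, RCLike.re_ofReal_mul, ← RCLike.ofReal_pow, RCLike.ofReal_re]
      ring
    rw [h5] at h1
    have h6 : c⁻¹ ^ 2 * RCLike.re ⟪R (R x), R x⟫_𝕜 ≤ c⁻¹ * ‖R x‖ ^ 2 := by
      calc _ ≤ c⁻¹ ^ 2 * (c * ‖R x‖ ^ 2) := by gcongr
        _ = _ := by field_simp
    have h7 : c⁻¹ * ‖R x‖ ^ 2 ≤ RCLike.re ⟪R x, x⟫_𝕜 := by linarith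
    calc ‖R x‖ ^ 2 = c * (c⁻¹ * ‖R x‖ ^ 2) := by field_simp
      _ ≤ _ := by gcongr
  have hcsa : IsSelfAdjoint ((c⁻¹ : ℝ) : 𝕜) := by simp [IsSelfAdjoint]
  have hXsa : IsSelfAdjoint (1 - ((c⁻¹ : ℝ) : 𝕜) • R) :=
    (IsSelfAdjoint.one _).sub (hcsa.smul hR.isSelfAdjoint)
  have hX1 : ‖(1 - ((c⁻¹ : ℝ) : 𝕜) • R)‖ ≤ 1 := by
    refine ContinuousLinearMap.opNorm_le_bound _ zero_le_one fun x => ?_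
    rw [one_mul]
    refine le_of_sq_le_sq ?_ (norm_nonneg _)
    have h8 : ‖(1 - ((c⁻¹ : ℝ) : 𝕜) • R) x‖ ^ 2 =
        ‖x‖ ^ 2 - 2 * c⁻¹ * RCLike.re ⟪R x, x⟫_𝕜 + c⁻¹ ^ 2 * ‖R x‖ ^ 2 := by
      have : (1 - ((c⁻¹ : ℝ) : 𝕜) • R) x = x - ((c⁻¹ : ℝ) : 𝕜) • R x := by simp
      rw [this, @norm_sub_sq 𝕜, inner_smul_right, RCLike.re_ofReal_mul,
        ← hR.inner_left_eq_inner_right, norm_smul, RCLike.norm_ofReal, mul_pow, sq_abs]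
      ring
    rw [h8]
    have h9 : c⁻¹ ^ 2 * ‖R x‖ ^ 2 ≤ c⁻¹ * RCLike.re ⟪R x, x⟫_𝕜 := by
      calc _ ≤ c⁻¹ ^ 2 * (c * RCLike.re ⟪R x, x⟫_𝕜) := by gcongr; exact hkey x
        _ = _ := by field_simp
    have h10 : 0 ≤ c⁻¹ * RCLike.re ⟪R x, x⟫_𝕜 :=
      mul_nonneg (inv_nonneg.2 hc.le) (hR.re_inner_nonneg_left x)
    linarith
  obtain ⟨Y, hY, hY1, hYX⟩ := exists_sqrt_of_norm_le _ hXsa hX1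
  refine ⟨((√c : ℝ) : 𝕜) • (1 - Y), ?_, ?_⟩
  · refine ContinuousLinearMap.IsPositive.smul_of_nonneg ?_ (by simp)
    rw [ContinuousLinearMap.isPositive_def']
    refine ⟨(IsSelfAdjoint.one _).sub hY, fun x => ?_⟩
    rw [ContinuousLinearMap.reApplyInnerSelf_apply]
    simp only [sub_apply, one_apply_eq_self, inner_sub_left,
      map_sub]
    have h1 := re_inner_le_norm (𝕜 := 𝕜) (Y x) x
    have h2 := Y.le_of_opNorm_le hY1 x
    rw [inner_self_eq_norm_sq]
    nlinarith [norm_nonneg x]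
  · rw [smul_mul_smul_comm, hYX, sub_sub_cancel, smul_smul, ← RCLike.ofReal_mul,
      ← RCLike.ofReal_mul, Real.mul_self_sqrt hc.le, mul_inv_cancel₀ hc.ne']
    simp

theorem IsPosInvertible.symm {A : H →ₗ.[𝕜] H} (hA : IsPosInvertible A) (x y : A.domain) :
    ⟪A x, (y : H)⟫_𝕜 = ⟪(x : H), A y⟫_𝕜 := by
  have h := LinearPMap.adjoint_isFormalAdjoint hA.selfAdjoint.dense_domain
  rw [LinearPMap.isSelfAdjoint_def.1 hA.selfAdjoint] at h
  exact h x y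

/-- A positive boundedly invertible self-adjoint operator has a positive square root. -/
theorem IsPosInvertible.exists_sqrt {A : H →ₗ.[𝕜] H} (hA : IsPosInvertible A) :
    ∃ S : H →ₗ.[𝕜] H, IsPosSqrt A S := by
  obtain ⟨R, hR1, hR2⟩ := hA.invertible
  have hsymm : ∀ y z, ⟪R y, z⟫_𝕜 = ⟪y, R z⟫_𝕜 := by
    intro y z
    obtain ⟨hy, ey⟩ := hR2 y
    obtain ⟨hz, ez⟩ := hR2 z
    have := hA.symm ⟨R y, hy⟩ ⟨R z, hz⟩
    rw [ey, ez] at this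
    exact this.symm
  have hRpos : R.IsPositive := by
    rw [ContinuousLinearMap.isPositive_def]
    refine ⟨fun y z => hsymm y z, fun y => ?_⟩
    obtain ⟨hy, ey⟩ := hR2 y
    have := hA.nonneg ⟨R y, hy⟩
    rw [ey] at this
    rw [ContinuousLinearMap.reApplyInnerSelf_apply, hsymm]
    exact this
  obtain ⟨Q, hQ, hQQ⟩ := exists_bounded_sqrt R hRpos
  have hQQ' : ∀ x, Q (Q x) = R x := fun x => by rw [← hQQ]; rfl
  have hQinj : Function.Injective (Q : H →ₗ[𝕜] H) := by
    rw [injective_iff_map_eq_zero]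
    intro x hx
    have h1 : R x = 0 := by
      rw [← hQQ']
      have : Q x = 0 := hx
      simp [this]
    obtain ⟨h, e⟩ := hR2 x
    have h2 : (⟨R x, h⟩ : A.domain) = 0 := Subtype.ext h1
    rw [← e, h2]
    exact A.map_zero
  let e := LinearEquiv.ofInjective (Q : H →ₗ[𝕜] H) hQinj
  let S : H →ₗ.[𝕜] H := ⟨LinearMap.range (Q : H →ₗ[𝕜] H), e.symm.toLinearMap⟩
  have hSQ : ∀ x : S.domain, Q (S x) = x := fun x =>
    congrArg Subtype.val (e.apply_symm_apply x)
  have hmem : ∀ x, Q x ∈ S.domain := fun x => ⟨x, rfl⟩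
  have hQS : ∀ x, S ⟨Q x, hmem x⟩ = x := fun x => e.symm_apply_apply x
  have hgraph : ∀ x y, (x, y) ∈ S.graph ↔ x = Q y := by
    intro x y
    rw [LinearPMap.mem_graph_iff]
    constructor
    · rintro ⟨z, hz, hz'⟩
      have := hSQ z
      rw [hz'] at this
      rw [this]
      exact hz.symm
    · rintro rfl
      exact ⟨⟨Q y, hmem y⟩, rfl, hQS y⟩
  have hdense : Dense (S.domain : Set H) := by
    rw [Submodule.dense_iff_topologicalClosure_eq_top,
      Submodule.topologicalClosure_eq_top_iff, Submodule.eq_bot_iff]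
    intro x hx
    apply hQinj
    rw [map_zero]
    refine ext_inner_left 𝕜 fun v => ?_
    rw [inner_zero_right]
    have := (Submodule.mem_orthogonal _ _).1 hx (Q v) (hmem v)
    rwa [hQ.inner_left_eq_inner_right] at this
  have hSsymm : S.IsFormalAdjoint S := by
    intro x y
    conv_lhs => rw [← hSQ y]
    conv_rhs => rw [← hSQ x]
    exact (hQ.inner_left_eq_inner_right _ _).symm
  refine ⟨S, ?_, ?_, ?_⟩
  · rw [LinearPMap.isSelfAdjoint_def]
    have hle := hSsymm.le_adjoint hdense
    refine (LinearPMap.eq_of_le_of_domain_eq hle (le_antisymm hle.1 ?_)).symm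
    intro y hy
    have h := LinearPMap.adjoint_isFormalAdjoint hdense
    refine ⟨S.adjoint ⟨y, hy⟩, ?_⟩
    refine ext_inner_right 𝕜 fun v => ?_
    have h1 := h ⟨y, hy⟩ ⟨Q v, hmem v⟩
    rw [hQS] at h1
    exact (hQ.inner_left_eq_inner_right _ _).trans h1
  · intro x
    have := hQ.re_inner_nonneg_right (S x)
    rwa [hSQ] at this
  · intro x y
    simp only [hgraph]
    have : (x, y) ∈ A.graph ↔ x = R y := by
      rw [LinearPMap.mem_graph_iff]
      constructor
      · rintro ⟨z, hz, hz'⟩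
        have h1 := hR1 z
        rw [hz'] at h1
        rw [h1]
        exact hz.symm
      · rintro rfl
        obtain ⟨h, e⟩ := hR2 y
        exact ⟨⟨R y, h⟩, rfl, e⟩
    rw [this]
    constructor
    · rintro rfl
      exact ⟨Q y, (hQQ' y).symm, rfl⟩
    · rintro ⟨z, rfl, rfl⟩
      exact hQQ' y

/-! ### The spaces `H_1 = D(A)` and `H_{1/2} = D(A^{1/2})` -/

/-- The positive square root `A^{1/2}`. -/
def IsPosInvertible.sqrt {A : H →ₗ.[𝕜] H} (hA : IsPosInvertible A) : H →ₗ.[𝕜] H :=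
  hA.exists_sqrt.choose

theorem IsPosInvertible.isPosSqrt_sqrt {A : H →ₗ.[𝕜] H} (hA : IsPosInvertible A) :
    IsPosSqrt A hA.sqrt :=
  hA.exists_sqrt.choose_spec

theorem IsPosInvertible.domain_le {A : H →ₗ.[𝕜] H} (hA : IsPosInvertible A) :
    A.domain ≤ hA.sqrt.domain := by
  intro x hx
  obtain ⟨z, hz, -⟩ := (hA.isPosSqrt_sqrt.sq x (A ⟨x, hx⟩)).1 (A.mem_graph ⟨x, hx⟩)
  exact LinearPMap.mem_domain_of_mem_graph hz

/-- The inclusion `H_1 ⊂ H_{1/2}`. -/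
def IsPosInvertible.incl {A : H →ₗ.[𝕜] H} (hA : IsPosInvertible A) :
    A.domain →ₗ[𝕜] hA.sqrt.domain :=
  Submodule.inclusion hA.domain_le

/-- `‖(x, y)‖²` in `H_{1/2} × H`. -/
def IsPosInvertible.energyNormSq {A : H →ₗ.[𝕜] H} (hA : IsPosInvertible A)
    (x : hA.sqrt.domain) (y : H) : ℝ :=
  ‖hA.sqrt x‖ ^ 2 + ‖y‖ ^ 2

/-- `‖(x, y)‖²` in `H_1 × H_{1/2}`. -/
def IsPosInvertible.regularNormSq {A : H →ₗ.[𝕜] H} (hA : IsPosInvertible A)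
    (x : A.domain) (y : hA.sqrt.domain) : ℝ :=
  ‖A x‖ ^ 2 + ‖hA.sqrt y‖ ^ 2

/-- `w` is the strong solution, with velocity `w'`, of `ẅ + A w + D ẇ = 0` on `[0, ∞)`,
`w(0) = w₀ ∈ H_1`, `ẇ(0) = w₁ ∈ H_{1/2}`, for a bounded operator `D` on `H`:
`w ∈ C([0,∞); H_1) ∩ C¹([0,∞); H_{1/2})`, `ẇ = w'` is differentiable in `H`, and the equation
holds in `H` at every `t ≥ 0`. Continuity and derivatives with values in `H_1` and `H_{1/2}`, whose
norms are `‖A ·‖` and `‖A^{1/2} ·‖`, are expressed after applying `A` and `A^{1/2}`; derivatives at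
`t = 0` are one-sided, and the values at `t < 0` play no role. -/
structure IsStrongSolution [NormedSpace ℝ H] {A : H →ₗ.[𝕜] H} (hA : IsPosInvertible A)
    (D : H →L[𝕜] H) (w : ℝ → A.domain) (w' : ℝ → hA.sqrt.domain)
    (w₀ : A.domain) (w₁ : hA.sqrt.domain) : Prop where
  initial_position : w 0 = w₀
  initial_velocity : w' 0 = w₁
  continuousOn_position : ContinuousOn (fun t => A (w t)) (Ici 0)
  continuousOn_velocity : ContinuousOn (fun t => hA.sqrt (w' t)) (Ici 0)
  hasDeriv_position : ∀ t ∈ Ici (0 : ℝ),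
    HasDerivWithinAt (fun s => hA.sqrt (hA.incl (w s))) (hA.sqrt (w' t)) (Ici 0) t
  equation : ∀ t ∈ Ici (0 : ℝ), ∃ w'' : H,
    HasDerivWithinAt (fun s => (w' s : H)) w'' (Ici 0) t ∧ w'' + A (w t) + D (w' t) = 0

/-- The weak observability inequality at time `T` with constant `C` and profile `h`, for the
conservative system `φ̈ + A φ = 0` observed through `B* φ̇`. -/
def WeakObservability [NormedSpace ℝ H] {A : H →ₗ.[𝕜] H} (hA : IsPosInvertible A)
    (B : U →L[𝕜] H) (h : ℝ → ℝ) (T C : ℝ) : Prop :=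
  ∀ (φ₀ : A.domain) (φ₁ : hA.sqrt.domain), (φ₀, φ₁) ≠ 0 →
    ∀ (φ : ℝ → A.domain) (φ' : ℝ → hA.sqrt.domain), IsStrongSolution hA 0 φ φ' φ₀ φ₁ →
      C * hA.regularNormSq φ₀ φ₁ *
          h (hA.energyNormSq (hA.incl φ₀) φ₁ / hA.regularNormSq φ₀ φ₁) ≤
        ∫ t in (0 : ℝ)..T, ‖ContinuousLinearMap.adjoint B (φ' t : H)‖ ^ 2

end WeakStab

end

/-! Put `Q = A^{-1/2}`, which is bounded, symmetric and injective. In the variables `a = A w`, `b =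
A^{1/2} ẇ` the equation reads `(Q a)' = b`, `(Q b)' = -a - D Q b` with `D = B B*` (`IsDampedFlow`),
so only bounded operators remain. The energy is `E = ‖Q a‖² + ‖Q b‖²`, the regular norm is `K = ‖a‖²
+ ‖b‖²`.

On a window `[s, s + T]` the damped solution is compared with the undamped one that has the same
data at time `s`. Since `‖D x‖² ≤ κ ⟪D x, x⟫`, a Gronwall argument bounds their difference by the
dissipated energy `E(s) - E(s + T)`, and hence also the observation of the undamped solution
(`integral_undamped_le`). Observability then gives `E(s + T) ≤ E(s) - δ₀ K(s) h(E(s) / K(s))`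
(`energy_step`). The undamped solution must be constructed: `exists_isDampedFlow_zero` obtains it
from the group generated by the inverse of a bounded skew operator.

Along the damped flow `K(s) ≤ M K(0)` (`regular_norm_le`), and the monotonicity of `h(x) / x` allows
`K(s)` to be replaced by `M K(0)` up to a constant. Thus `e_k = E(kT) / (M K(0))` satisfies `e_{k+1}
≤ e_k - δ h(e_k)`. Because `h(c x) ≤ c h(x)` for `c ≤ 1`, the numbers `y_k = h(e_k)` satisfy
`y_{k+1} ≤ y_k - δ y_k²`, so they decay like `1 / k`; inverting `h` gives the rate
(`profile_decay_of_step`). -/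

namespace WeakStab

/-! ### The group generated by the inverse of a bounded skew operator -/

section SkewGroup

variable {K : Type*} [NormedAddCommGroup K] [InnerProductSpace ℝ K] [CompleteSpace K]

theorem hasDerivAt_exp_smul_apply (G : K →L[ℝ] K) (x : K) (t : ℝ) :
    HasDerivAt (fun s : ℝ => NormedSpace.exp (s • G) x) (NormedSpace.exp (t • G) (G x)) t :=
  (hasDerivAt_exp_smul_const (𝕂 := ℝ) G t).clm_apply (hasDerivAt_const t x) |>.congr_deriv
    (by simp)

/-- The exponential of a skew operator is isometric. -/
theorem norm_exp_smul_apply_of_skew {G : K →L[ℝ] K} (hG : ∀ x, ⟪G x, x⟫_ℝ = 0) (x : K) (t : ℝ) :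
    ‖NormedSpace.exp (t • G) x‖ = ‖x‖ := by
  have hd : ∀ s, HasDerivAt (fun s : ℝ => ‖NormedSpace.exp (s • G) x‖ ^ 2) 0 s := by
    intro s
    refine (hasDerivAt_exp_smul_apply G x s).norm_sq.congr_deriv ?_
    have hc : NormedSpace.exp (s • G) (G x) = G (NormedSpace.exp (s • G) x) :=
      (DFunLike.congr_fun ((Commute.refl G).smul_right s).exp_right.eq x).symm
    rw [hc, real_inner_comm, hG, mul_zero]
  have h := is_const_of_deriv_eq_zero (fun s => (hd s).differentiableAt)
    (fun s => (hd s).deriv) t 0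
  simp only [zero_smul, NormedSpace.exp_zero, one_apply_eq_self] at h
  exact (sq_eq_sq₀ (norm_nonneg _) (norm_nonneg _)).1 h

/-- The derivative `exp(sG) (G x)` has constant norm `‖G x‖`, so this is the mean value inequality.
-/
theorem norm_exp_smul_apply_sub_self_le {G : K →L[ℝ] K} (hG : ∀ x, ⟪G x, x⟫_ℝ = 0) (x : K)
    (t : ℝ) : ‖NormedSpace.exp (t • G) x - x‖ ≤ ‖G x‖ * |t| := by
  have h := convex_univ.norm_image_sub_le_of_norm_hasDerivWithin_le (x := (0 : ℝ)) (y := t)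
    (fun s _ => (hasDerivAt_exp_smul_apply G x s).hasDerivWithinAt)
    (fun s _ => (norm_exp_smul_apply_of_skew hG (G x) s).le) (mem_univ _) (mem_univ _)
  simpa using h

/-- By commutation `exp(tG) = exp(tF) exp(t(G - F))`. The first factor is an isometry and `G - F` is
again skew, so the bound for the displacement of a single orbit applies. This makes convergence of
generators imply convergence of orbits. -/
theorem norm_exp_smul_apply_sub_le {G F : K →L[ℝ] K} (hG : ∀ x, ⟪G x, x⟫_ℝ = 0)
    (hF : ∀ x, ⟪F x, x⟫_ℝ = 0) (hc : Commute G F) (x : K) (t : ℝ) :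
    ‖NormedSpace.exp (t • G) x - NormedSpace.exp (t • F) x‖ ≤ ‖G x - F x‖ * |t| := by
  have hc' : Commute (t • F) (t • (G - F)) :=
    ((hc.symm.sub_right (Commute.refl F)).smul_right t).smul_left t
  let _ : NormedAlgebra ℚ (K →L[ℝ] K) := NormedAlgebra.restrictScalars ℚ ℝ (K →L[ℝ] K)
  have hexp : NormedSpace.exp (t • G) =
      NormedSpace.exp (t • F) * NormedSpace.exp (t • (G - F)) := by
    rw [← NormedSpace.exp_add_of_commute hc', ← smul_add, add_sub_cancel]
  have hGF : ∀ y, ⟪(G - F) y, y⟫_ℝ = 0 := fun y => by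
    simp [inner_sub_left, hG, hF]
  rw [hexp, mul_apply_eq_comp, ← map_sub, norm_exp_smul_apply_of_skew hF]
  exact norm_exp_smul_apply_sub_self_le hGF x t

/-- The operator `ε - J²` is boundedly invertible when `J` is skew and `ε > 0`. -/
theorem exists_resolvent_of_skew {J : K →L[ℝ] K} (hJ : ∀ x y, ⟪J x, y⟫_ℝ = -⟪x, J y⟫_ℝ)
    {ε : ℝ} (hε : 0 < ε) :
    ∃ N : K →L[ℝ] K, (∀ F, Commute F J → Commute F N) ∧ ∀ x, ε • N x - J (J (N x)) = x := by
  set S : K →L[ℝ] K := ε • 1 - J * J with hS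
  have hSx : ∀ x, ⟪S x, x⟫_ℝ = ε * ‖x‖ * ‖x‖ + ‖J x‖ * ‖J x‖ := by
    intro x
    have : S x = ε • x - J (J x) := rfl
    rw [this, inner_sub_left, inner_smul_left, hJ (J x), real_inner_self_eq_norm_mul_norm,
      real_inner_self_eq_norm_mul_norm]
    simp
    ring
  -- Lax–Milgram: skewness turns `-⟪J (J x), x⟫` into `‖J x‖²`, so `ε` is a coercivity constant.
  have hcoer : IsCoercive ((innerSL ℝ).comp S) := by
    refine ⟨ε, hε, fun u => ?_⟩
    have : ((innerSL ℝ).comp S) u u = ⟪S u, u⟫_ℝ := rfl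
    rw [this, hSx]
    nlinarith [mul_self_nonneg ‖J u‖]
  have he : ∀ v, hcoer.continuousLinearEquivOfBilin v = S v := fun v =>
    ext_inner_right ℝ fun w => hcoer.continuousLinearEquivOfBilin_apply v w
  have hunit : IsUnit S := by
    rw [ContinuousLinearMap.isUnit_iff_bijective]
    have := hcoer.continuousLinearEquivOfBilin.bijective
    rwa [show (⇑hcoer.continuousLinearEquivOfBilin : K → K) = S from funext he] at this
  obtain ⟨u, hu⟩ := hunit
  refine ⟨↑u⁻¹, fun F hF => Commute.units_inv_right ?_, fun x => ?_⟩
  · rw [hu]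
    exact ((Commute.one_right F).smul_right _).sub_right (hF.mul_right hF)
  · have h1 : ((u : K →L[ℝ] K) * ↑u⁻¹) x = x := by
      rw [u.mul_inv]
      rfl
    rwa [hu] at h1

/-- Bounded skew approximations of the inverse of a bounded skew operator. -/
theorem exists_approx_inverse_of_skew {J : K →L[ℝ] K} (hJ : ∀ x y, ⟪J x, y⟫_ℝ = -⟪x, J y⟫_ℝ) :
    ∃ G : ℕ → (K →L[ℝ] K), (∀ n x, ⟪G n x, x⟫_ℝ = 0) ∧ (∀ n m, Commute (G n) (G m)) ∧
      (∀ n, Commute J (G n)) ∧ (∀ n x, ‖J (G n x) - x‖ ≤ ‖x‖) ∧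
      ∀ n x, ‖J (G n (J (J x))) - J (J x)‖ ≤ 2 / (n + 1) * ‖x‖ := by
  have hε : ∀ n : ℕ, (0 : ℝ) < 1 / (n + 1) := fun n => Nat.one_div_pos_of_nat
  choose N hcN hsol using fun n : ℕ => exists_resolvent_of_skew hJ (hε n)
  have hJN : ∀ n, Commute J (N n) := fun n => hcN n J (Commute.refl J)
  have hNN : ∀ n m, Commute (N n) (N m) := fun n m => hcN m _ (hJN n).symm
  have hcomm : ∀ (n : ℕ) x, N n (J x) = J (N n x) := fun n x =>
    (DFunLike.congr_fun (hJN n).eq x).symm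
  -- Pairing the resolvent equation with `N n x` gives `ε ‖N n x‖² ≤ ‖x‖ ‖N n x‖`, where `ε = 1 / (n
  -- + 1)`.
  have hbound : ∀ (n : ℕ) x, ‖(1 / ((n : ℝ) + 1)) • N n x‖ ≤ ‖x‖ := by
    intro n x
    have h2 : ⟪x, N n x⟫_ℝ = 1 / ((n : ℝ) + 1) * ‖N n x‖ ^ 2 + ‖J (N n x)‖ ^ 2 := by
      have h1 := hsol n x
      generalize N n x = z at h1 ⊢
      rw [← h1, inner_sub_left, inner_smul_left, hJ (J z), real_inner_self_eq_norm_sq,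
        real_inner_self_eq_norm_sq]
      simp
    have h3 := real_inner_le_norm x (N n x)
    rw [norm_smul, Real.norm_of_nonneg (hε n).le]
    rcases (norm_nonneg (N n x)).eq_or_lt with h0 | h0
    · rw [← h0, mul_zero]
      exact norm_nonneg _
    · refine le_of_mul_le_mul_right ?_ h0
      nlinarith [sq_nonneg ‖J (N n x)‖]
  -- The approximation is `G = -J N`: from `ε N - J² N = 1` follows `J G = 1 - ε N`, whose error is
  -- bounded by `hbound` and is small on the range of `J²`.
  have hJG : ∀ (n : ℕ) x, J ((-(J * N n)) x) - x = -((1 / ((n : ℝ) + 1)) • N n x) := by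
    intro n x
    have h1 : J ((-(J * N n)) x) = -J (J (N n x)) := by simp
    rw [h1]
    have h2 := hsol n x
    generalize J (J (N n x)) = p at h2 ⊢
    generalize (1 / ((n : ℝ) + 1)) • N n x = q at h2 ⊢
    rw [← h2]
    abel
  refine ⟨fun n => -(J * N n), ?_, ?_, ?_, ?_, ?_⟩
  · intro n x
    have h1 : (-(J * N n)) x = -J (N n x) := by simp
    have h2 : ∀ z, ⟪J z, z⟫_ℝ = 0 := fun z => by
      have := hJ z z
      rw [real_inner_comm] at this
      rw [real_inner_comm]
      linarith
    rw [h1]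
    have h3 := hsol n x
    generalize N n x = z at h3 ⊢
    rw [← h3, inner_neg_left, inner_sub_right, inner_smul_right, h2, real_inner_comm, h2]
    simp
  · intro n m
    exact (((Commute.refl J).mul_right (hJN m)).mul_left
      ((hJN n).symm.mul_right (hNN n m))).neg_left.neg_right
  · intro n
    exact ((Commute.refl J).mul_right (hJN n)).neg_right
  · intro n x
    rw [hJG, norm_neg]
    exact hbound n x
  · intro n x
    rw [hJG, norm_neg, hcomm, hcomm]
    have h1 : J (J (N n x)) = (1 / ((n : ℝ) + 1)) • N n x - x := by
      have h2 := hsol n x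
      generalize J (J (N n x)) = p at h2 ⊢
      generalize (1 / ((n : ℝ) + 1)) • N n x = q at h2 ⊢
      rw [← h2]
      abel
    rw [h1, norm_smul, Real.norm_of_nonneg (hε n).le]
    have h2 := norm_sub_le ((1 / ((n : ℝ) + 1)) • N n x) x
    have h3 := hbound n x
    calc _ ≤ 1 / ((n : ℝ) + 1) * (2 * ‖x‖) := by
          have := (hε n).le
          gcongr
          linarith
      _ = _ := by ring

/-- The strongly continuous group whose generator is the inverse of a bounded skew operator `J`:
for every `x` the equation `(J y)' = y`, `y(0) = x` has a continuous solution. -/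
theorem exists_orbit_of_skew {J : K →L[ℝ] K} (hJ : ∀ x y, ⟪J x, y⟫_ℝ = -⟪x, J y⟫_ℝ)
    (hd : DenseRange J) (x : K) :
    ∃ y : ℝ → K, Continuous y ∧ y 0 = x ∧ ∀ t, HasDerivAt (fun s => J (y s)) (y t) t := by
  obtain ⟨G, hskew, hcomm, hJG, hle, hrate⟩ := exists_approx_inverse_of_skew hJ
  -- On the range of `J²` the error `J (G n ·) - ·` has a rate. One more factor `J` is needed for a
  -- rate of `G n` itself: `G n (J³ z)` tends to `J² z`.
  have hd2 : DenseRange fun z => J (J z) := hd.comp hd J.continuous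
  have hd3 : DenseRange fun z => J (J (J z)) := hd.comp hd2 J.continuous
  have hJG' : ∀ n z, J (G n z) = G n (J z) := fun n z => DFunLike.congr_fun (hJG n).eq z
  have hsmall : ∀ c : ℝ, ∀ δ > 0, ∃ n₀ : ℕ, ∀ n ≥ n₀, 2 / ((n : ℝ) + 1) * c < δ := by
    intro c δ hδ
    have h1 : Filter.Tendsto (fun n : ℕ => 1 / ((n : ℝ) + 1) * (2 * c)) Filter.atTop
        (nhds (0 * (2 * c))) := tendsto_one_div_add_atTop_nhds_zero_nat.mul_const _
    rw [zero_mul] at h1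
    obtain ⟨n₀, h⟩ := Filter.eventually_atTop.1 (h1.eventually (gt_mem_nhds hδ))
    refine ⟨n₀, fun n hn => ?_⟩
    have := h n hn
    calc _ = 1 / ((n : ℝ) + 1) * (2 * c) := by ring
      _ < δ := this
  set Y : ℕ → ℝ → K := fun n t => NormedSpace.exp (t • G n) x with hY
  have hYd : ∀ n t, HasDerivAt (Y n) (NormedSpace.exp (t • G n) (G n x)) t := fun n t =>
    hasDerivAt_exp_smul_apply (G n) x t
  have hcauchy : ∀ r, UniformCauchySeqOn Y Filter.atTop (Metric.closedBall (0 : ℝ) r) := by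
    intro r
    rw [Metric.uniformCauchySeqOn_iff]
    intro δ hδ
    obtain ⟨z, hz⟩ := hd3.exists_dist_lt x (show 0 < δ / 4 by positivity)
    obtain ⟨n₀, hn₀⟩ := hsmall (‖z‖ * |r|) (δ / 4) (by positivity)
    refine ⟨n₀, fun m hm n hn t ht => ?_⟩
    have ht' : |t| ≤ |r| := by
      have : |t| ≤ r := by simpa using ht
      exact this.trans (le_abs_self r)
    rw [dist_eq_norm] at hz ⊢
    -- Density argument: the isometries act on the small remainder `x - J³ z` without enlarging it,
    -- while on `J³ z` the generators are close.
    have hsplit : ∀ k, Y k t = NormedSpace.exp (t • G k) (x - J (J (J z))) +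
        NormedSpace.exp (t • G k) (J (J (J z))) := fun k => by rw [← map_add, sub_add_cancel]
    have h1 := norm_exp_smul_apply_sub_le (hskew m) (hskew n) (hcomm m n) (J (J (J z))) t
    have hk : ∀ k, ‖G k (J (J (J z))) - J (J z)‖ ≤ 2 / (k + 1) * ‖z‖ := fun k => by
      rw [← hJG']
      exact hrate k z
    have h2 : ‖G m (J (J (J z))) - G n (J (J (J z)))‖ ≤
        2 / (m + 1) * ‖z‖ + 2 / (n + 1) * ‖z‖ := by
      rw [← sub_sub_sub_cancel_right _ _ (J (J z))]
      exact (norm_sub_le _ _).trans (add_le_add (hk m) (hk n))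
    have h3 : ‖NormedSpace.exp (t • G m) (J (J (J z))) -
        NormedSpace.exp (t • G n) (J (J (J z)))‖ < δ / 4 + δ / 4 := by
      refine h1.trans_lt (lt_of_le_of_lt ?_ (add_lt_add (hn₀ m hm) (hn₀ n hn)))
      calc _ ≤ (2 / (m + 1) * ‖z‖ + 2 / (n + 1) * ‖z‖) * |r| := by gcongr
        _ = _ := by ring
    rw [hsplit m, hsplit n, add_sub_add_comm]
    refine (norm_add_le _ _).trans_lt ?_
    have h4 := norm_sub_le (NormedSpace.exp (t • G m) (x - J (J (J z))))
      (NormedSpace.exp (t • G n) (x - J (J (J z))))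
    rw [norm_exp_smul_apply_of_skew (hskew m), norm_exp_smul_apply_of_skew (hskew n)] at h4
    linarith
  have hlim : ∀ t, ∃ l, Filter.Tendsto (fun n => Y n t) Filter.atTop (nhds l) := fun t =>
    cauchySeq_tendsto_of_complete
      ((hcauchy |t|).cauchySeq (x := t) (by simp))
  choose y hy using hlim
  have hunif : ∀ r, TendstoUniformlyOn Y y Filter.atTop (Metric.closedBall (0 : ℝ) r) := fun r =>
    (hcauchy r).tendstoUniformlyOn_of_tendsto fun t _ => hy t
  -- Strong convergence of `J (G n)` to the identity, from the rate on a dense set and the uniform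
  -- bound `hle`.
  have hremainder : ∀ δ > 0, ∃ n₀ : ℕ, ∀ n ≥ n₀, ‖J (G n x) - x‖ < δ := by
    intro δ hδ
    obtain ⟨z, hz⟩ := hd2.exists_dist_lt x (show 0 < δ / 2 by positivity)
    obtain ⟨n₀, hn₀⟩ := hsmall ‖z‖ (δ / 2) (by positivity)
    refine ⟨n₀, fun n hn => ?_⟩
    rw [dist_eq_norm] at hz
    have h1 : J (G n x) - x = (J (G n (x - J (J z))) - (x - J (J z))) +
        (J (G n (J (J z))) - J (J z)) := by
      simp only [map_sub]
      abel
    rw [h1]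
    refine (norm_add_le _ _).trans_lt ?_
    have h2 := hle n (x - J (J z))
    have h3 := (hrate n z).trans_lt (hn₀ n hn)
    linarith
  set Y' : ℕ → ℝ → K := fun n t => J (NormedSpace.exp (t • G n) (G n x)) with hY'
  -- The derivative of `J (Y n)` differs from `Y n` by an isometric image of `J (G n x) - x`, so the
  -- error does not depend on `t` and the derivatives converge uniformly too.
  have hY'Y : ∀ n t, Y' n t - Y n t = NormedSpace.exp (t • G n) (J (G n x) - x) := by
    intro n t
    have hc : J (NormedSpace.exp (t • G n) (G n x)) = NormedSpace.exp (t • G n) (J (G n x)) :=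
      DFunLike.congr_fun ((hJG n).smul_right t).exp_right.eq (G n x)
    rw [map_sub, ← hc]
  have hloc : ∀ {F : ℕ → ℝ → K},
      (∀ r, TendstoUniformlyOn F y Filter.atTop (Metric.closedBall (0 : ℝ) r)) →
      TendstoLocallyUniformlyOn F y Filter.atTop univ := by
    intro F hF
    rw [tendstoLocallyUniformlyOn_univ, tendstoLocallyUniformly_iff_forall_isCompact]
    intro k hk
    obtain ⟨r, hr⟩ := hk.isBounded.subset_closedBall (0 : ℝ)
    exact (hF r).mono hr
  have hunif' : ∀ r, TendstoUniformlyOn Y' y Filter.atTop (Metric.closedBall (0 : ℝ) r) := by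
    intro r
    rw [Metric.tendstoUniformlyOn_iff]
    intro δ hδ
    obtain ⟨n₀, hn₀⟩ := hremainder (δ / 2) (by positivity)
    filter_upwards [Metric.tendstoUniformlyOn_iff.1 (hunif r) (δ / 2) (by positivity),
      Filter.eventually_ge_atTop n₀] with n hn hn' t ht
    have h1 := hn t ht
    have h2 := hn₀ n hn'
    have h3 : dist (Y n t) (Y' n t) < δ / 2 := by
      rw [dist_comm, dist_eq_norm, hY'Y, norm_exp_smul_apply_of_skew (hskew n)]
      exact h2
    linarith [dist_triangle (y t) (Y n t) (Y' n t)]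
  refine ⟨y, ?_, ?_, fun t => ?_⟩
  · refine (tendstoLocallyUniformlyOn_univ.1 (hloc hunif)).continuous
      (Filter.Frequently.of_forall fun n => ?_)
    exact continuous_iff_continuousAt.2 fun t => (hYd n t).continuousAt
  · refine tendsto_nhds_unique (hy 0) (tendsto_const_nhds.congr fun n => ?_)
    simp [hY]
  · refine hasDerivAt_of_tendstoLocallyUniformlyOn (f := fun n s => J (Y n s)) isOpen_univ
      (hloc hunif') (Filter.Eventually.of_forall fun n s _ => ?_)
      (fun s _ => (J.continuous.tendsto _).comp (hy s)) (mem_univ t)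
    exact J.hasFDerivAt.comp_hasDerivAt s (hYd n s)

end SkewGroup

/-! ### Damped and undamped flows: existence, energy identities, comparison -/

section Flow

variable {H : Type*} [NormedAddCommGroup H] [InnerProductSpace ℝ H]

/-- A vector orthogonal to the range of a skew operator lies in its kernel. -/
theorem denseRange_of_skew_of_injective [CompleteSpace H] {J : H →L[ℝ] H}
    (hJ : ∀ x y, ⟪J x, y⟫_ℝ = -⟪x, J y⟫_ℝ) (hinj : ∀ x, J x = 0 → x = 0) : DenseRange J := by
  have hdense : Dense (LinearMap.range (J : H →ₗ[ℝ] H) : Set H) := by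
    rw [Submodule.dense_iff_topologicalClosure_eq_top,
      Submodule.topologicalClosure_eq_top_iff, Submodule.eq_bot_iff]
    intro x hx
    refine hinj x (ext_inner_left ℝ fun v => ?_)
    have h : ⟪J v, x⟫_ℝ = 0 := (Submodule.mem_orthogonal _ _).1 hx (J v) ⟨v, rfl⟩
    rw [hJ, neg_eq_zero] at h
    rw [inner_zero_right, h]
  exact hdense

/-- `(a, b)` represents a solution of `ẅ + A w + D ẇ = 0` with `A = Q⁻²`, through `a = A w` and
`b = A^{1/2} ẇ`. -/
structure IsDampedFlow (Q D : H →L[ℝ] H) (a b : ℝ → H) : Prop where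
  continuousOn_fst : ContinuousOn a (Ici 0)
  continuousOn_snd : ContinuousOn b (Ici 0)
  hasDeriv_fst : ∀ t ∈ Ici (0 : ℝ), HasDerivWithinAt (fun s => Q (a s)) (b t) (Ici 0) t
  hasDeriv_snd : ∀ t ∈ Ici (0 : ℝ),
    HasDerivWithinAt (fun s => Q (b s)) (-a t - D (Q (b t))) (Ici 0) t

/-- The undamped equation is solvable for all initial data. -/
theorem exists_isDampedFlow_zero [CompleteSpace H] {Q : H →L[ℝ] H}
    (hQ : ∀ x y, ⟪Q x, y⟫_ℝ = ⟪x, Q y⟫_ℝ) (hinj : ∀ x, Q x = 0 → x = 0) (a₀ b₀ : H) :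
    ∃ a b : ℝ → H, a 0 = a₀ ∧ b 0 = b₀ ∧ IsDampedFlow Q 0 a b := by
  let e := WithLp.prodContinuousLinearEquiv 2 ℝ H H
  -- For `y = (a, b)` this is `J y = (-Q b, Q a)`, so `(J y)' = y` is the undamped system. `WithLp
  -- 2` gives the product its Hilbert norm, in which `J` is skew.
  let J : WithLp 2 (H × H) →L[ℝ] WithLp 2 (H × H) :=
    (e.symm : (H × H) →L[ℝ] WithLp 2 (H × H)) ∘L
      ((-(Q ∘L ContinuousLinearMap.snd ℝ H H)).prod (Q ∘L ContinuousLinearMap.fst ℝ H H)) ∘L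
      (e : WithLp 2 (H × H) →L[ℝ] H × H)
  have hJ1 : ∀ x, (e (J x)).1 = -Q (e x).2 := fun x => by simp [J]
  have hJ2 : ∀ x, (e (J x)).2 = Q (e x).1 := fun x => by simp [J]
  have hinner : ∀ x y : WithLp 2 (H × H),
      ⟪x, y⟫_ℝ = ⟪(e x).1, (e y).1⟫_ℝ + ⟪(e x).2, (e y).2⟫_ℝ := fun x y =>
    WithLp.prod_inner_apply x y
  have hJ : ∀ x y, ⟪J x, y⟫_ℝ = -⟪x, J y⟫_ℝ := by
    intro x y
    rw [hinner, hinner, hJ1, hJ2, hJ1, hJ2, inner_neg_left, inner_neg_right, hQ, hQ]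
    ring
  have hJinj : ∀ x, J x = 0 → x = 0 := by
    intro x hx
    have h1 := hJ1 x
    have h2 := hJ2 x
    rw [hx, map_zero] at h1 h2
    refine e.injective ?_
    rw [map_zero]
    exact Prod.ext (hinj _ h2.symm) (hinj _ (neg_eq_zero.1 h1.symm))
  obtain ⟨y, hyc, hy0, hyd⟩ := exists_orbit_of_skew hJ
    (denseRange_of_skew_of_injective hJ hJinj) (e.symm (a₀, b₀))
  have hey : Continuous fun t => e (y t) := e.continuous.comp hyc
  have hed : ∀ t, HasDerivAt (fun s => e (J (y s))) (e (y t)) t := fun t =>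
    (e : WithLp 2 (H × H) →L[ℝ] H × H).hasFDerivAt.comp_hasDerivAt t (hyd t)
  refine ⟨fun t => (e (y t)).1, fun t => (e (y t)).2, by simp [hy0], by simp [hy0],
    hey.fst.continuousOn, hey.snd.continuousOn, fun t _ => ?_, fun t _ => ?_⟩
  · have h := (ContinuousLinearMap.snd ℝ H H).hasFDerivAt.comp_hasDerivAt t (hed t)
    refine (h.congr_of_eventuallyEq (Filter.Eventually.of_forall fun s => ?_)).hasDerivWithinAt
    exact (hJ2 (y s)).symm
  · have h := ((ContinuousLinearMap.fst ℝ H H).hasFDerivAt.comp_hasDerivAt t (hed t)).neg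
    refine ((h.congr_of_eventuallyEq (Filter.Eventually.of_forall fun s => ?_)).congr_deriv
      ?_).hasDerivWithinAt
    · have := hJ1 (y s)
      simp [this]
    · simp

theorem hasDerivWithinAt_energy {Q : H →L[ℝ] H} (hQ : ∀ x y, ⟪Q x, y⟫_ℝ = ⟪x, Q y⟫_ℝ)
    {a b : ℝ → H} {f : H} {s : Set ℝ} {t : ℝ}
    (ha : HasDerivWithinAt (fun r => Q (a r)) (b t) s t)
    (hb : HasDerivWithinAt (fun r => Q (b r)) (-a t - f) s t) :
    HasDerivWithinAt (fun r => ‖Q (a r)‖ ^ 2 + ‖Q (b r)‖ ^ 2) (-2 * ⟪Q (b t), f⟫_ℝ) s t := by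
  refine (ha.norm_sq.add hb.norm_sq).congr_deriv ?_
  rw [hQ (a t), real_inner_comm, inner_sub_right, inner_neg_right]
  ring

theorem antitoneOn_Ici_of_hasDerivWithinAt_nonpos {f f' : ℝ → ℝ}
    (hf : ∀ t ∈ Ici (0 : ℝ), HasDerivWithinAt f (f' t) (Ici 0) t)
    (hf' : ∀ t ∈ Ici (0 : ℝ), f' t ≤ 0) : AntitoneOn f (Ici 0) :=
  antitoneOn_of_hasDerivWithinAt_nonpos (convex_Ici 0)
    (fun t ht => (hf t ht).continuousWithinAt)
    (fun t ht => (hf t (interior_subset ht)).mono interior_subset)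
    (fun t ht => hf' t (interior_subset ht))

namespace IsDampedFlow

variable {Q D : H →L[ℝ] H} {a b : ℝ → H}

theorem hasDerivWithinAt_energy (hF : IsDampedFlow Q D a b)
    (hQ : ∀ x y, ⟪Q x, y⟫_ℝ = ⟪x, Q y⟫_ℝ) {t : ℝ} (ht : t ∈ Ici (0 : ℝ)) :
    HasDerivWithinAt (fun r => ‖Q (a r)‖ ^ 2 + ‖Q (b r)‖ ^ 2)
      (-2 * ⟪D (Q (b t)), Q (b t)⟫_ℝ) (Ici 0) t := by
  rw [real_inner_comm]
  exact WeakStab.hasDerivWithinAt_energy hQ (hF.hasDeriv_fst t ht) (hF.hasDeriv_snd t ht)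

theorem antitoneOn_energy (hF : IsDampedFlow Q D a b)
    (hQ : ∀ x y, ⟪Q x, y⟫_ℝ = ⟪x, Q y⟫_ℝ) (hD : ∀ x, 0 ≤ ⟪D x, x⟫_ℝ) :
    AntitoneOn (fun t => ‖Q (a t)‖ ^ 2 + ‖Q (b t)‖ ^ 2) (Ici 0) :=
  antitoneOn_Ici_of_hasDerivWithinAt_nonpos (fun _ ht => hF.hasDerivWithinAt_energy hQ ht)
    fun t _ => by linarith [hD (Q (b t))]

theorem shift (hF : IsDampedFlow Q D a b) {τ : ℝ} (hτ : 0 ≤ τ) :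
    IsDampedFlow Q D (fun t => a (t + τ)) (fun t => b (t + τ)) := by
  have hmaps : MapsTo (fun t : ℝ => t + τ) (Ici 0) (Ici 0) := fun t ht => add_nonneg ht hτ
  have hcont : ContinuousOn (fun t : ℝ => t + τ) (Ici 0) := by fun_prop
  have hd : ∀ t : ℝ, HasDerivWithinAt (fun t : ℝ => t + τ) 1 (Ici 0) t := fun t =>
    ((hasDerivAt_id t).add_const τ).hasDerivWithinAt
  refine ⟨hF.continuousOn_fst.comp hcont hmaps, hF.continuousOn_snd.comp hcont hmaps,
    fun t ht => ?_, fun t ht => ?_⟩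
  · exact ((hF.hasDeriv_fst _ (hmaps ht)).scomp t (hd t) hmaps).congr_deriv (one_smul _ _)
  · exact ((hF.hasDeriv_snd _ (hmaps ht)).scomp t (hd t) hmaps).congr_deriv (one_smul _ _)

theorem sub {a' b' : ℝ → H} (hF : IsDampedFlow Q D a b) (hF' : IsDampedFlow Q D a' b') :
    IsDampedFlow Q D (fun t => a t - a' t) (fun t => b t - b' t) := by
  refine ⟨hF.continuousOn_fst.sub hF'.continuousOn_fst,
    hF.continuousOn_snd.sub hF'.continuousOn_snd, fun t ht => ?_, fun t ht => ?_⟩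
  · simp only [map_sub]
    exact (hF.hasDeriv_fst t ht).sub (hF'.hasDeriv_fst t ht)
  · simp only [map_sub]
    refine ((hF.hasDeriv_snd t ht).sub (hF'.hasDeriv_snd t ht)).congr_deriv ?_
    abel

/-- The right derivatives of `Q a` and `Q b` are `b` and `-(a + D Q b)`. The left side is `τ⁻²`
times the energy of the difference of two flows, so energy monotonicity passes to the limit. -/
theorem tendsto_slope_energy (hF : IsDampedFlow Q D a b) {t : ℝ} (ht : 0 ≤ t) :
    Filter.Tendsto (fun τ : ℝ => (τ⁻¹) ^ 2 *
        (‖Q (a (τ + t)) - Q (a t)‖ ^ 2 + ‖Q (b (τ + t)) - Q (b t)‖ ^ 2))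
      (nhdsWithin 0 (Ioi 0)) (nhds (‖b t‖ ^ 2 + ‖a t + D (Q (b t))‖ ^ 2)) := by
  have hs := hF.shift ht
  have h1 := ((hs.hasDeriv_fst 0 self_mem_Ici).mono Ioi_subset_Ici_self)
  have h2 := ((hs.hasDeriv_snd 0 self_mem_Ici).mono Ioi_subset_Ici_self)
  rw [hasDerivWithinAt_iff_tendsto_slope' self_notMem_Ioi] at h1 h2
  simp only [zero_add] at h1 h2
  have h3 := (h1.norm.pow 2).add (h2.norm.pow 2)
  rw [show -a t - D (Q (b t)) = -(a t + D (Q (b t))) by abel, norm_neg] at h3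
  refine h3.congr fun τ => ?_
  simp only [slope, sub_zero, vsub_eq_sub, norm_smul, zero_add, mul_pow, norm_inv, inv_pow,
    Real.norm_eq_abs, sq_abs]
  ring

/-- The energy of the velocity does not increase. -/
theorem velocity_energy_le (hF : IsDampedFlow Q D a b)
    (hQ : ∀ x y, ⟪Q x, y⟫_ℝ = ⟪x, Q y⟫_ℝ) (hD : ∀ x, 0 ≤ ⟪D x, x⟫_ℝ) {t : ℝ} (ht : 0 ≤ t) :
    ‖b t‖ ^ 2 + ‖a t + D (Q (b t))‖ ^ 2 ≤ ‖b 0‖ ^ 2 + ‖a 0 + D (Q (b 0))‖ ^ 2 := by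
  refine le_of_tendsto_of_tendsto (hF.tendsto_slope_energy ht)
    (hF.tendsto_slope_energy le_rfl) ?_
  filter_upwards [self_mem_nhdsWithin] with τ hτ
  have hτ0 : (0 : ℝ) ≤ τ := le_of_lt hτ
  -- By linearity and time invariance, the shifted flow minus the flow is itself a damped flow.
  have h := ((hF.shift hτ0).sub hF).antitoneOn_energy hQ hD self_mem_Ici ht ht
  simp only [map_sub] at h
  rw [add_comm τ t, add_comm τ 0]
  gcongr

/-- The regular norm stays bounded along the flow. -/
theorem regular_norm_le (hF : IsDampedFlow Q D a b)
    (hQ : ∀ x y, ⟪Q x, y⟫_ℝ = ⟪x, Q y⟫_ℝ) (hD : ∀ x, 0 ≤ ⟪D x, x⟫_ℝ) {t : ℝ} (ht : 0 ≤ t) :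
    ‖a t‖ ^ 2 + ‖b t‖ ^ 2 ≤ (2 + 2 * ‖D ∘L Q‖ ^ 2) ^ 2 * (‖a 0‖ ^ 2 + ‖b 0‖ ^ 2) := by
  set d := ‖D ∘L Q‖ with hd
  have hDQ : ∀ x, ‖D (Q x)‖ ^ 2 ≤ d ^ 2 * ‖x‖ ^ 2 := fun x => by
    rw [← mul_pow]
    gcongr
    exact (D ∘L Q).le_opNorm x
  have hsq : ∀ x y : H, ‖x + y‖ ^ 2 ≤ 2 * ‖x‖ ^ 2 + 2 * ‖y‖ ^ 2 := fun x y => by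
    have := parallelogram_law_with_norm ℝ x y
    nlinarith [mul_self_nonneg ‖x - y‖]
  -- `velocity_energy_le` controls `a + D Q b` instead of `a`; the correction `D Q b` is bounded by
  -- `‖b‖`, at time `t` and at time `0` alike.
  have h1 : ‖a t‖ ^ 2 ≤ 2 * ‖a t + D (Q (b t))‖ ^ 2 + 2 * (d ^ 2 * ‖b t‖ ^ 2) := by
    have h := hsq (a t + D (Q (b t))) (-D (Q (b t)))
    rw [add_neg_cancel_right, norm_neg] at h
    linarith [hDQ (b t)]
  have h2 : ‖a 0 + D (Q (b 0))‖ ^ 2 ≤ 2 * ‖a 0‖ ^ 2 + 2 * (d ^ 2 * ‖b 0‖ ^ 2) := by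
    linarith [hsq (a 0) (D (Q (b 0))), hDQ (b 0)]
  have h3 := hF.velocity_energy_le hQ hD ht
  have hd0 : 0 ≤ d ^ 2 := sq_nonneg d
  calc ‖a t‖ ^ 2 + ‖b t‖ ^ 2
      ≤ (2 + 2 * d ^ 2) * (‖b t‖ ^ 2 + ‖a t + D (Q (b t))‖ ^ 2) := by
        nlinarith [mul_nonneg hd0 (sq_nonneg ‖a t + D (Q (b t))‖), sq_nonneg ‖b t‖]
    _ ≤ (2 + 2 * d ^ 2) * (‖b 0‖ ^ 2 + ‖a 0 + D (Q (b 0))‖ ^ 2) := by gcongr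
    _ ≤ (2 + 2 * d ^ 2) * ((2 + 2 * d ^ 2) * (‖a 0‖ ^ 2 + ‖b 0‖ ^ 2)) := by
        gcongr
        nlinarith [mul_nonneg hd0 (sq_nonneg ‖a 0‖), sq_nonneg ‖b 0‖]
    _ = _ := by ring

/-- The energy of the difference between the damped and the undamped solution is controlled by
the dissipated energy. -/
theorem energy_sub_undamped_le {α β : ℝ → H} (hF : IsDampedFlow Q D a b)
    (hF₀ : IsDampedFlow Q 0 α β) (h0 : α 0 = a 0) (h0' : β 0 = b 0)
    (hQ : ∀ x y, ⟪Q x, y⟫_ℝ = ⟪x, Q y⟫_ℝ)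
    {κ : ℝ} (hκ : ∀ x, ‖D x‖ ^ 2 ≤ κ * ⟪D x, x⟫_ℝ) {t : ℝ} (ht : 0 ≤ t) :
    ‖Q (b t - β t)‖ ^ 2 ≤ Real.exp t * (κ / 2 *
      ((‖Q (a 0)‖ ^ 2 + ‖Q (b 0)‖ ^ 2) - (‖Q (a t)‖ ^ 2 + ‖Q (b t)‖ ^ 2))) := by
  have hψ : ∀ s ∈ Ici (0 : ℝ), HasDerivWithinAt
      (fun r => ‖Q (a r - α r)‖ ^ 2 + ‖Q (b r - β r)‖ ^ 2)
      (-2 * ⟪Q (b s - β s), D (Q (b s))⟫_ℝ) (Ici 0) s := by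
    intro s hs
    refine WeakStab.hasDerivWithinAt_energy (a := fun r => a r - α r) (b := fun r => b r - β r)
      hQ ?_ ?_
    · simp only [map_sub]
      exact (hF.hasDeriv_fst s hs).sub (hF₀.hasDeriv_fst s hs)
    · simp only [map_sub]
      refine ((hF.hasDeriv_snd s hs).sub (hF₀.hasDeriv_snd s hs)).congr_deriv ?_
      simp
      abel
  have hexp : ∀ s : ℝ, HasDerivWithinAt (fun r => Real.exp (-r)) (-Real.exp (-s)) (Ici 0) s :=
    fun s => by simpa using ((hasDerivAt_neg s).exp).hasDerivWithinAt
  -- Gronwall: with `ψ` the energy of the difference, `ψ' ≤ ψ + κ ⟪D Q b, Q b⟫`, and the last term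
  -- is `-(κ / 2) E'`. So `e^{-t} ψ + (κ / 2) E` is nonincreasing, and `ψ(0) = 0`.
  have hanti := antitoneOn_Ici_of_hasDerivWithinAt_nonpos (fun s hs =>
    ((hexp s).mul (hψ s hs)).add ((hF.hasDerivWithinAt_energy hQ hs).const_mul (κ / 2))) (by
      intro s hs
      have hκs := hκ (Q (b s))
      have he : Real.exp (-s) ≤ 1 := Real.exp_le_one_iff.2 (neg_nonpos.2 hs)
      have he0 := Real.exp_pos (-s)
      have hi : -2 * ⟪Q (b s - β s), D (Q (b s))⟫_ℝ ≤
          ‖Q (b s - β s)‖ ^ 2 + ‖D (Q (b s))‖ ^ 2 := by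
        have := norm_add_sq_real (Q (b s - β s)) (D (Q (b s)))
        nlinarith [sq_nonneg ‖Q (b s - β s) + D (Q (b s))‖]
      have hD0 := sq_nonneg ‖D (Q (b s))‖
      have h1 := mul_le_mul_of_nonneg_left hi he0.le
      have h2 := mul_le_mul_of_nonneg_right he hD0
      have h3 := mul_nonneg he0.le (sq_nonneg ‖Q (a s - α s)‖)
      nlinarith)
  have h := hanti self_mem_Ici ht ht
  simp only [Pi.add_apply, Pi.mul_apply, h0, h0', sub_self, map_zero, norm_zero] at h
  have h1 : Real.exp (-t) * ‖Q (b t - β t)‖ ^ 2 ≤ κ / 2 *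
      ((‖Q (a 0)‖ ^ 2 + ‖Q (b 0)‖ ^ 2) - (‖Q (a t)‖ ^ 2 + ‖Q (b t)‖ ^ 2)) := by
    have h3 := mul_nonneg (Real.exp_pos (-t)).le (sq_nonneg ‖Q (a t - α t)‖)
    nlinarith
  have h2 := mul_le_mul_of_nonneg_left h1 (Real.exp_pos t).le
  rwa [← mul_assoc, ← Real.exp_add, add_neg_cancel, Real.exp_zero, one_mul] at h2

/-- The observation of the undamped solution is controlled by the energy that the damped solution
dissipates. -/
theorem integral_undamped_le {α β : ℝ → H} (hF : IsDampedFlow Q D a b)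
    (hF₀ : IsDampedFlow Q 0 α β) (h0 : α 0 = a 0) (h0' : β 0 = b 0)
    (hQ : ∀ x y, ⟪Q x, y⟫_ℝ = ⟪x, Q y⟫_ℝ) (hD : ∀ x, 0 ≤ ⟪D x, x⟫_ℝ)
    {κ : ℝ} (hκ0 : 0 ≤ κ) (hκ : ∀ x, ‖D x‖ ^ 2 ≤ κ * ⟪D x, x⟫_ℝ) {T : ℝ} (hT : 0 ≤ T) :
    ∫ t in (0 : ℝ)..T, ⟪D (Q (β t)), Q (β t)⟫_ℝ ≤ (1 + T * (‖D‖ * Real.exp T * κ)) *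
      ((‖Q (a 0)‖ ^ 2 + ‖Q (b 0)‖ ^ 2) - (‖Q (a T)‖ ^ 2 + ‖Q (b T)‖ ^ 2)) := by
  set E : ℝ → ℝ := fun t => ‖Q (a t)‖ ^ 2 + ‖Q (b t)‖ ^ 2 with hE
  -- `c` bounds `2 ⟪D Q (b - β), Q (b - β)⟫` throughout `[0, T]`.
  set c := ‖D‖ * Real.exp T * κ * (E 0 - E T) with hc
  have hanti : AntitoneOn E (Ici 0) := hF.antitoneOn_energy hQ hD
  have hcont : ∀ γ : ℝ → H, ContinuousOn γ (Ici 0) →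
      ContinuousOn (fun t => ⟪D (Q (γ t)), Q (γ t)⟫_ℝ) (uIcc 0 T) := by
    intro γ hγ
    have hγ' : ContinuousOn (fun t => Q (γ t)) (uIcc 0 T) :=
      Q.continuous.comp_continuousOn (hγ.mono (by rw [uIcc_of_le hT]; exact Icc_subset_Ici_self))
    exact (D.continuous.comp_continuousOn hγ').inner hγ'
  have hint : IntervalIntegrable (fun t => 2 * ⟪D (Q (b t)), Q (b t)⟫_ℝ + c) volume 0 T :=
    (((hcont b hF.continuousOn_snd).const_mul 2).add continuousOn_const).intervalIntegrable
  have hFTC : ∫ t in (0 : ℝ)..T, (2 * ⟪D (Q (b t)), Q (b t)⟫_ℝ + c) =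
      (-E T + c * T) - (-E 0 + c * 0) := by
    refine intervalIntegral.integral_eq_sub_of_hasDeriv_right_of_le
      (f := fun t => -E t + c * t) hT ?_ ?_ hint
    · refine ContinuousOn.add (ContinuousOn.neg fun t ht => ?_) (by fun_prop)
      exact (hF.hasDerivWithinAt_energy hQ ht.1).continuousWithinAt.mono Icc_subset_Ici_self
    · intro t ht
      have h1 : HasDerivWithinAt E _ (Ioi t) t :=
        (hF.hasDerivWithinAt_energy hQ ht.1.le).mono (Ioi_subset_Ici ht.1.le)
      have h2 : HasDerivWithinAt (fun t => c * t) (c * 1) (Ioi t) t :=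
        ((hasDerivAt_id t).const_mul c).hasDerivWithinAt
      exact (h1.neg.add h2).congr_deriv (by ring)
  have hmono : ∫ t in (0 : ℝ)..T, ⟪D (Q (β t)), Q (β t)⟫_ℝ ≤
      ∫ t in (0 : ℝ)..T, (2 * ⟪D (Q (b t)), Q (b t)⟫_ℝ + c) := by
    refine intervalIntegral.integral_mono_on hT
      (hcont β hF₀.continuousOn_snd).intervalIntegrable hint fun t ht => ?_
    have h1 := hF.energy_sub_undamped_le hF₀ h0 h0' hQ hκ ht.1
    have hET : E T ≤ E t := hanti ht.1 hT ht.2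
    have hE0 : E t ≤ E 0 := hanti self_mem_Ici ht.1 ht.1
    have h2 : ‖Q (b t - β t)‖ ^ 2 ≤ Real.exp T * (κ / 2 * (E 0 - E T)) := by
      refine h1.trans ?_
      have h5 : 0 ≤ E 0 - E t := by linarith
      have h6 : Real.exp t ≤ Real.exp T := Real.exp_le_exp.2 ht.2
      change Real.exp t * (κ / 2 * (E 0 - E t)) ≤ _
      gcongr
    have h3 : ⟪D (Q (b t - β t)), Q (b t - β t)⟫_ℝ ≤ ‖D‖ * ‖Q (b t - β t)‖ ^ 2 := by
      have h5 := real_inner_le_norm (D (Q (b t - β t))) (Q (b t - β t))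
      have h6 := D.le_opNorm (Q (b t - β t))
      nlinarith [norm_nonneg (Q (b t - β t))]
    have h4 := mul_le_mul_of_nonneg_left h2 (norm_nonneg D)
    -- With `q(x) = ⟪D x, x⟫` and `q(u + v) ≥ 0`, the parallelogram identity gives `q(u - v) ≤ 2
    -- q(u) + 2 q(v)`, for `u = Q b` and `v = Q (b - β)`.
    have h5 := hD (Q (b t) + Q (b t - β t))
    have h6 : Q (β t) = Q (b t) - Q (b t - β t) := by rw [← map_sub, sub_sub_cancel]
    rw [h6]
    simp only [map_add, map_sub D, inner_add_left, inner_add_right, inner_sub_left,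
      inner_sub_right] at h5 ⊢
    rw [hc]
    linarith
  refine hmono.trans (hFTC.le.trans (le_of_eq ?_))
  rw [hc]
  ring

end IsDampedFlow

end Flow

/-! ### From a discrete dissipation inequality to the decay rate -/

section Profile

variable {h : ℝ → ℝ}

theorem profile_mul_le (h_div : MonotoneOn (fun x => h x / x) (Ioo 0 1)) {x c : ℝ} (hx : 0 < x)
    (hx1 : x < 1) (hc : 0 < c) (hc1 : c ≤ 1) : h (c * x) ≤ c * h x := by
  have hcx : 0 < c * x := mul_pos hc hx
  have hle : c * x ≤ x := mul_le_of_le_one_left hx.le hc1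
  have h1 : h (c * x) / (c * x) ≤ h x / x := h_div ⟨hcx, hle.trans_lt hx1⟩ ⟨hx, hx1⟩ hle
  rw [div_le_div_iff₀ hcx hx] at h1
  nlinarith

/-- The ratio `E / K` can exceed `1`, where `h(x) / x` need not be monotone. There `h(x) / x ≤ 2
h(1/2) ≤ 2 h(y) ≤ 2X h(y) / y`, so monotonicity survives up to the factor `2X`. -/
theorem profile_div_le (h_maps : MapsTo h (Ioi 0) (Ioi 0)) (h_mono : StrictMonoOn h (Ioi 0))
    (h_div : MonotoneOn (fun x => h x / x) (Ioo 0 1)) {x y X : ℝ} (hx : 0 < x) (hx1 : x ≤ 1 / 2)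
    (hxy : x ≤ y) (hyX : y ≤ X) (hX : 1 ≤ X) : h x / x ≤ 2 * X * (h y / y) := by
  have hy : 0 < y := hx.trans_le hxy
  have hhy : 0 < h y := h_maps hy
  have hq : 0 < h y / y := div_pos hhy hy
  rcases lt_or_ge y 1 with hy1 | hy1
  · have h1 : h x / x ≤ h y / y := h_div ⟨hx, by linarith⟩ ⟨hy, hy1⟩ hxy
    nlinarith
  · have h1 : h x / x ≤ h (1 / 2) / (1 / 2) :=
      h_div ⟨hx, by linarith⟩ ⟨by norm_num, by norm_num⟩ hx1
    have h2 : h (1 / 2) ≤ h y :=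
      h_mono.monotoneOn (show (0 : ℝ) < 1 / 2 by norm_num) hy (by linarith)
    have h3 : h y ≤ X * (h y / y) := by
      rw [← mul_div_assoc, le_div_iff₀ hy, mul_comm]
      gcongr
    linarith

/-- A discrete form of `y' ≤ -δ y²` for `y = h(e_k)`. As `e_k ≤ 1`, the step gives `e_{k+1} / e_k ≤
1 - δ y`, which `profile_mul_le` transfers to `h`. If `y s ≤ 1`, then `(1 - δ y) y (s + δ) ≤ (1 - δ
y)(1 + δ y) ≤ 1`. -/
theorem profile_seq_decay (h_maps : MapsTo h (Ioi 0) (Ioi 0)) (h_mono : StrictMonoOn h (Ioi 0))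
    (h_div : MonotoneOn (fun x => h x / x) (Ioo 0 1)) {e : ℕ → ℝ} {δ : ℝ} (hδ : 0 < δ)
    (he1 : ∀ k, e k ≤ 1 / 2)
    (hanti : ∀ k, e (k + 1) ≤ e k) (hstep : ∀ k, 0 < e k → e (k + 1) ≤ e k - δ * h (e k))
    (k : ℕ) (hk : 0 < e k) : h (e k) * (1 / h (1 / 2) + δ * k) ≤ 1 := by
  have hhalf : (0 : ℝ) < h (1 / 2) := h_maps (show (0 : ℝ) < 1 / 2 by norm_num)
  induction k with
  | zero =>
    have h1 : h (e 0) ≤ h (1 / 2) :=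
      h_mono.monotoneOn hk (show (0 : ℝ) < 1 / 2 by norm_num) (he1 0)
    rw [Nat.cast_zero, mul_zero, add_zero, mul_one_div]
    exact (div_le_one hhalf).2 h1
  | succ k ih =>
    have hk0 : 0 < e k := hk.trans_le (hanti k)
    have ih := ih hk0
    set y := h (e k) with hy
    set s := 1 / h (1 / 2) + δ * k with hs
    have hy0 : 0 < y := h_maps hk0
    have hs0 : 0 < s := by positivity
    have h1 : h (e (k + 1)) ≤ e (k + 1) / e k * y := by
      have h2 := profile_mul_le h_div hk0 (by linarith [he1 k]) (div_pos hk hk0)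
        ((div_le_one hk0).2 (hanti k))
      rwa [div_mul_cancel₀ _ hk0.ne'] at h2
    have h2 : e (k + 1) / e k ≤ 1 - δ * y := by
      rw [div_le_iff₀ hk0]
      have h3 := hstep k hk0
      have h4 : δ * y * e k ≤ δ * y * 1 :=
        mul_le_mul_of_nonneg_left (by linarith [he1 k]) (by positivity)
      rw [← hy] at h3
      linarith
    have h3 : 0 < 1 - δ * y := (div_pos hk hk0).trans_le h2
    have h4 : h (e (k + 1)) ≤ (1 - δ * y) * y :=
      h1.trans (mul_le_mul_of_nonneg_right h2 hy0.le)
    have h5 : 1 / h (1 / 2) + δ * ((k + 1 : ℕ) : ℝ) = s + δ := by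
      rw [hs]
      push_cast
      ring
    rw [h5]
    calc h (e (k + 1)) * (s + δ) ≤ (1 - δ * y) * y * (s + δ) := by gcongr
      _ = (1 - δ * y) * (y * s + δ * y) := by ring
      _ ≤ (1 - δ * y) * (1 + δ * y) := by gcongr
      _ ≤ 1 := by nlinarith [sq_nonneg (δ * y)]

/-- Dissipation of a nonincreasing energy `E` at a rate that the profile `h` prescribes gives
decay like `h⁻¹(1 / (1 + t))`. -/
theorem profile_decay_of_step (h_maps : MapsTo h (Ioi 0) (Ioi 0)) (h_mono : StrictMonoOn h (Ioi 0))
    (h_div : MonotoneOn (fun x => h x / x) (Ioo 0 1)) {T δ₀ X M : ℝ} (hT : 0 < T)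
    (hδ₀ : 0 < δ₀) (hX : 1 ≤ X) (hM : 2 * X ≤ M) {E K : ℝ → ℝ} (hK0 : 0 < K 0)
    (hanti : AntitoneOn E (Ici 0)) (hEK : ∀ s, E s ≤ X * K s)
    (hKM : ∀ s, 0 ≤ s → K s ≤ M * K 0)
    (hdiss : ∀ s, 0 ≤ s → 0 < K s → E (T + s) ≤ E s - δ₀ * (K s * h (E s / K s)))
    {t : ℝ} (ht : 0 ≤ t) (hrange : 1 / (1 + t) ∈ h '' Ioi 0) :
    E t ≤ (1 + (1 + T) * (h (1 / 2) + 1 / (δ₀ / (2 * X)))) * M *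
      Function.invFunOn h (Ioi 0) (1 / (1 + t)) * K 0 := by
  set δ : ℝ := δ₀ / (2 * X) with hδ
  -- Chosen so that `a₀ (1 / h(1/2) + δ k) ≥ (1 + T)(1 + k) ≥ 1 + t` when `t ≤ (k + 1) T`: the
  -- summand `h(1/2)` produces the `1`, and `1 / δ` produces the `k`.
  set a₀ : ℝ := 1 + (1 + T) * (h (1 / 2) + 1 / δ) with ha₀
  have hX0 : 0 < X := by linarith
  have hM0 : 0 < M := by linarith
  have hδ0 : 0 < δ := by positivity
  have hhalf : (0 : ℝ) < h (1 / 2) := h_maps (show (0 : ℝ) < 1 / 2 by norm_num)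
  have ha₀1 : 1 ≤ a₀ := by
    rw [ha₀]
    have : 0 ≤ (1 + T) * (h (1 / 2) + 1 / δ) := by positivity
    linarith
  have hMK : 0 < M * K 0 := mul_pos hM0 hK0
  have hhalfM : ∀ s, 0 ≤ s → E s / (M * K 0) ≤ 1 / 2 := fun s hs => by
    have h1 : E s ≤ X * K 0 := (hanti self_mem_Ici hs hs).trans (hEK 0)
    have h2 : 2 * X * K 0 ≤ M * K 0 := by gcongr
    rw [div_le_iff₀ hMK]
    linarith
  obtain ⟨hy, hhy⟩ : Function.invFunOn h (Ioi 0) (1 / (1 + t)) ∈ Ioi 0 ∧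
      h (Function.invFunOn h (Ioi 0) (1 / (1 + t))) = 1 / (1 + t) :=
    ⟨Function.invFunOn_mem hrange, Function.invFunOn_eq hrange⟩
  set y := Function.invFunOn h (Ioi 0) (1 / (1 + t))
  set k := ⌊t / T⌋₊ with hk
  have hkt : (k : ℝ) * T ≤ t := by
    rw [← le_div_iff₀ hT]
    exact Nat.floor_le (by positivity)
  have hkt' : t ≤ (k + 1) * T := by
    rw [← div_le_iff₀ hT]
    exact (Nat.lt_floor_add_one _).le
  set e : ℕ → ℝ := fun k => E (k * T) / (M * K 0) with he
  have hkT : ∀ k : ℕ, (0 : ℝ) ≤ k * T := fun k => by positivity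
  have hsucc : ∀ k : ℕ, ((k + 1 : ℕ) : ℝ) * T = T + k * T := fun k => by
    push_cast
    ring
  have hstep : ∀ k, 0 < e k → e (k + 1) ≤ e k - δ * h (e k) := by
    intro k hek
    have hEpos : 0 < E (k * T) := by
      by_contra hneg
      exact absurd hek (not_lt.2 (div_nonpos_of_nonpos_of_nonneg (not_lt.1 hneg) hMK.le))
    have hKpos : 0 < K (k * T) := by
      by_contra hneg
      nlinarith [hEK (k * T)]
    have h1 : E (T + k * T) ≤ E (k * T) - δ₀ * (K (k * T) * h (E (k * T) / K (k * T))) :=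
      hdiss _ (hkT k) hKpos
    -- Since `K(kT) ≤ M K(0)`, the normalised energy `e k` lies below the true ratio `E / K`. This
    -- exchanges the unknown `K(kT)` for a fixed constant.
    have h2 := profile_div_le h_maps h_mono h_div hek (hhalfM _ (hkT k))
      (div_le_div_of_nonneg_left hEpos.le hKpos (hKM _ (hkT k)))
      (show E (k * T) / K (k * T) ≤ X by
        rw [div_le_iff₀ hKpos]
        exact hEK (k * T)) hX
    have h3 : h (e k) / e k * e k ≤ 2 * X * (h (E (k * T) / K (k * T)) / (E (k * T) / K (k * T))) *
        e k := mul_le_mul_of_nonneg_right h2 hek.le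
    rw [div_mul_cancel₀ _ hek.ne'] at h3
    have h4 : h (E (k * T) / K (k * T)) / (E (k * T) / K (k * T)) * e k =
        K (k * T) * h (E (k * T) / K (k * T)) / (M * K 0) := by
      simp only [he]
      field_simp
    rw [mul_assoc, h4] at h3
    have h5 : e (k + 1) ≤ e k - δ₀ * (K (k * T) * h (E (k * T) / K (k * T)) / (M * K 0)) := by
      simp only [he, hsucc]
      rw [← mul_div_assoc, ← sub_div]
      gcongr
    have h6 : δ * h (e k) ≤ δ₀ * (K (k * T) * h (E (k * T) / K (k * T)) / (M * K 0)) := by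
      rw [hδ, div_mul_eq_mul_div, div_le_iff₀ (by positivity)]
      calc _ ≤ δ₀ * (2 * X * (K (k * T) * h (E (k * T) / K (k * T)) / (M * K 0))) := by gcongr
        _ = _ := by ring
    linarith
  have hmon : ∀ k, e (k + 1) ≤ e k := fun k => by
    simp only [he]
    gcongr
    refine hanti (hkT k) (hkT (k + 1)) ?_
    rw [hsucc]
    linarith
  have hEt : E t ≤ e k * (M * K 0) := by
    simp only [he]
    rw [div_mul_cancel₀ _ hMK.ne']
    exact hanti (hkT k) ht hkt
  have hfin : e k ≤ a₀ * y := by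
    rcases le_or_gt (e k) 0 with h0 | h0
    · exact h0.trans (mul_nonneg (by linarith) (le_of_lt hy))
    have hek1 : e k ≤ 1 / 2 := hhalfM _ (hkT k)
    have h1 := profile_seq_decay h_maps h_mono h_div hδ0 (fun k => hhalfM _ (hkT k)) hmon hstep k h0
    have ha₀0 : 0 < a₀ := by linarith
    have h2 := profile_mul_le h_div h0 (by linarith) (one_div_pos.2 ha₀0)
      ((div_le_one ha₀0).2 ha₀1)
    have h3 : 1 + t ≤ a₀ * (1 / h (1 / 2) + δ * k) := by
      have h4 : a₀ * (1 / h (1 / 2) + δ * k) = (1 / h (1 / 2) + δ * k) +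
          (1 + T) * (1 + k + (h (1 / 2) * (δ * k) + 1 / δ * (1 / h (1 / 2)))) := by
        rw [ha₀]
        field_simp
        ring
      have h5 : 0 ≤ (1 / h (1 / 2) + δ * k) := by positivity
      have h6 : 0 ≤ (1 + T) * (h (1 / 2) * (δ * k) + 1 / δ * (1 / h (1 / 2))) := by positivity
      have h7 : (0 : ℝ) ≤ k := Nat.cast_nonneg k
      rw [h4]
      nlinarith
    -- The constant is moved inside `h`, so that strict monotonicity can compare `e k / a₀` with
    -- `y`.
    have h4 : h (1 / a₀ * e k) ≤ h y := by
      rw [hhy, le_div_iff₀ (by positivity)]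
      have h5 : 0 < h (e k) := h_maps h0
      calc h (1 / a₀ * e k) * (1 + t) ≤ (1 / a₀ * h (e k)) * (a₀ * (1 / h (1 / 2) + δ * k)) := by
            gcongr
        _ = h (e k) * (1 / h (1 / 2) + δ * k) := by field_simp
        _ ≤ 1 := h1
    have h5 := (h_mono.le_iff_le (show 1 / a₀ * e k ∈ Ioi 0 from by
      have := mul_pos (one_div_pos.2 ha₀0) h0
      exact this) hy).1 h4
    rw [one_div_mul_eq_div, div_le_iff₀ ha₀0] at h5
    linarith
  calc E t ≤ e k * (M * K 0) := hEt
    _ ≤ a₀ * y * (M * K 0) := by gcongr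
    _ = _ := by ring

end Profile

/-! ### Decay of damped flows from observability of undamped ones -/

section Decay

variable {H : Type*} [NormedAddCommGroup H] [InnerProductSpace ℝ H]

theorem IsDampedFlow.energy_step [CompleteSpace H] {Q D : H →L[ℝ] H} {a b : ℝ → H}
    (hF : IsDampedFlow Q D a b)
    (hQ : ∀ x y, ⟪Q x, y⟫_ℝ = ⟪x, Q y⟫_ℝ) (hinj : ∀ x, Q x = 0 → x = 0)
    (hD : ∀ x, 0 ≤ ⟪D x, x⟫_ℝ) {κ : ℝ} (hκ0 : 0 ≤ κ) (hκ : ∀ x, ‖D x‖ ^ 2 ≤ κ * ⟪D x, x⟫_ℝ)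
    {h : ℝ → ℝ} {T C : ℝ} (hT : 0 ≤ T)
    (hobs : ∀ α β : ℝ → H, IsDampedFlow Q 0 α β → 0 < ‖α 0‖ ^ 2 + ‖β 0‖ ^ 2 →
      C * (‖α 0‖ ^ 2 + ‖β 0‖ ^ 2) *
          h ((‖Q (α 0)‖ ^ 2 + ‖Q (β 0)‖ ^ 2) / (‖α 0‖ ^ 2 + ‖β 0‖ ^ 2)) ≤
        ∫ t in (0 : ℝ)..T, ⟪D (Q (β t)), Q (β t)⟫_ℝ)
    {t : ℝ} (ht : 0 ≤ t) (hpos : 0 < ‖a t‖ ^ 2 + ‖b t‖ ^ 2) :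
    ‖Q (a (T + t))‖ ^ 2 + ‖Q (b (T + t))‖ ^ 2 ≤ (‖Q (a t)‖ ^ 2 + ‖Q (b t)‖ ^ 2) -
      C / (1 + T * (‖D‖ * Real.exp T * κ)) * ((‖a t‖ ^ 2 + ‖b t‖ ^ 2) *
        h ((‖Q (a t)‖ ^ 2 + ‖Q (b t)‖ ^ 2) / (‖a t‖ ^ 2 + ‖b t‖ ^ 2))) := by
  obtain ⟨α, β, hα, hβ, hF₀⟩ := exists_isDampedFlow_zero hQ hinj (a t) (b t)
  have h1 := hobs α β hF₀ (by rwa [hα, hβ])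
  have h2 := (hF.shift ht).integral_undamped_le hF₀ (by rw [hα, zero_add]) (by rw [hβ, zero_add])
    hQ hD hκ0 hκ hT
  rw [hα, hβ] at h1
  simp only [zero_add] at h2
  have hc : 0 < 1 + T * (‖D‖ * Real.exp T * κ) := by positivity
  rw [le_sub_comm, div_mul_eq_mul_div, div_le_iff₀ hc]
  linarith

/-- The decay estimate for damped flows under a weak observability inequality for the undamped
flow. -/
theorem exists_decay_constant [CompleteSpace H] {Q D : H →L[ℝ] H}
    (hQ : ∀ x y, ⟪Q x, y⟫_ℝ = ⟪x, Q y⟫_ℝ) (hinj : ∀ x, Q x = 0 → x = 0)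
    (hD : ∀ x, 0 ≤ ⟪D x, x⟫_ℝ) {κ : ℝ} (hκ0 : 0 ≤ κ) (hκ : ∀ x, ‖D x‖ ^ 2 ≤ κ * ⟪D x, x⟫_ℝ)
    {h : ℝ → ℝ} (h_maps : MapsTo h (Ioi 0) (Ioi 0)) (h_mono : StrictMonoOn h (Ioi 0))
    (h_div : MonotoneOn (fun x => h x / x) (Ioo 0 1)) {T C : ℝ} (hT : 0 < T) (hC : 0 < C)
    (hobs : ∀ α β : ℝ → H, IsDampedFlow Q 0 α β → 0 < ‖α 0‖ ^ 2 + ‖β 0‖ ^ 2 →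
      C * (‖α 0‖ ^ 2 + ‖β 0‖ ^ 2) *
          h ((‖Q (α 0)‖ ^ 2 + ‖Q (β 0)‖ ^ 2) / (‖α 0‖ ^ 2 + ‖β 0‖ ^ 2)) ≤
        ∫ t in (0 : ℝ)..T, ⟪D (Q (β t)), Q (β t)⟫_ℝ) :
    ∃ C₁ : ℝ, 0 < C₁ ∧ ∀ a b : ℝ → H, IsDampedFlow Q D a b → 0 < ‖a 0‖ ^ 2 + ‖b 0‖ ^ 2 →
      ∀ t : ℝ, 0 ≤ t → 1 / (1 + t) ∈ h '' Ioi 0 →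
        ‖Q (a t)‖ ^ 2 + ‖Q (b t)‖ ^ 2 ≤
          C₁ * Function.invFunOn h (Ioi 0) (1 / (1 + t)) * (‖a 0‖ ^ 2 + ‖b 0‖ ^ 2) := by
  set X : ℝ := 1 + ‖Q‖ ^ 2 with hX
  -- The first summand bounds the growth of `K`; the second keeps the normalised energies at most
  -- `1/2`.
  set M : ℝ := (2 + 2 * ‖D ∘L Q‖ ^ 2) ^ 2 + 2 * X with hM
  set δ₀ : ℝ := C / (1 + T * (‖D‖ * Real.exp T * κ)) with hδ₀
  have hX1 : 1 ≤ X := by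
    rw [hX]
    linarith [sq_nonneg ‖Q‖]
  have hX0 : 0 < X := by linarith
  have hM0 : 0 < M := by positivity
  have hδ₀0 : 0 < δ₀ := by positivity
  have hhalf : (0 : ℝ) < h (1 / 2) := h_maps (show (0 : ℝ) < 1 / 2 by norm_num)
  refine ⟨(1 + (1 + T) * (h (1 / 2) + 1 / (δ₀ / (2 * X)))) * M, by positivity,
    fun a b hF hK0 t ht hrange => ?_⟩
  set E : ℝ → ℝ := fun t => ‖Q (a t)‖ ^ 2 + ‖Q (b t)‖ ^ 2 with hE
  set K : ℝ → ℝ := fun t => ‖a t‖ ^ 2 + ‖b t‖ ^ 2 with hK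
  have hK0' : 0 < K 0 := hK0
  have hanti : AntitoneOn E (Ici 0) := hF.antitoneOn_energy hQ hD
  have hEK : ∀ s, E s ≤ X * K s := fun s => by
    have h1 := Q.le_opNorm (a s)
    have h2 := Q.le_opNorm (b s)
    have h3 : ‖Q (a s)‖ ^ 2 ≤ ‖Q‖ ^ 2 * ‖a s‖ ^ 2 := by
      rw [← mul_pow]
      gcongr
    have h4 : ‖Q (b s)‖ ^ 2 ≤ ‖Q‖ ^ 2 * ‖b s‖ ^ 2 := by
      rw [← mul_pow]
      gcongr
    simp only [hE, hK, hX]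
    linarith [sq_nonneg ‖a s‖, sq_nonneg ‖b s‖]
  have hKM : ∀ s, 0 ≤ s → K s ≤ M * K 0 := fun s hs => by
    have h1 : K s ≤ (2 + 2 * ‖D ∘L Q‖ ^ 2) ^ 2 * K 0 := hF.regular_norm_le hQ hD hs
    have h2 : 0 ≤ 2 * X * K 0 := by positivity
    rw [hM]
    linarith
  exact profile_decay_of_step h_maps h_mono h_div hT hδ₀0 hX1 (by
    rw [hM]
    linarith [sq_nonneg (2 + 2 * ‖D ∘L Q‖ ^ 2)]) hK0 hanti hEK hKM
    (fun s hs hKs => hF.energy_step hQ hinj hD hκ0 hκ hT.le hobs hs hKs) ht hrange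

end Decay

/-! ### The bounded inverse of the square root -/

section Translation

variable {𝕜 H : Type*} [RCLike 𝕜] [NormedAddCommGroup H] [InnerProductSpace 𝕜 H]

/-- The real part of a `𝕜`-inner product, as a real inner product over the given real normed space
structure. -/
abbrev realInnerProductSpace (𝕜 H : Type*) [RCLike 𝕜] [NormedAddCommGroup H]
    [InnerProductSpace 𝕜 H] [i : NormedSpace ℝ H] [IsScalarTower ℝ 𝕜 H] :
    InnerProductSpace ℝ H where
  toNormedSpace := i
  inner x y := RCLike.re ⟪x, y⟫_𝕜
  norm_sq_eq_re_inner x := (inner_self_eq_norm_sq (𝕜 := 𝕜) x).symm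
  conj_inner_symm x y := inner_re_symm y x
  add_left x y z := by rw [inner_add_left, map_add]
  smul_left x y r := by
    rw [← algebraMap_smul 𝕜 r x, inner_smul_left]
    simp

variable [CompleteSpace H]

/-- The square root of a positive boundedly invertible operator is boundedly invertible. -/
theorem IsPosInvertible.exists_sqrt_inverse {A : H →ₗ.[𝕜] H} (hA : IsPosInvertible A) :
    ∃ Q : H →L[𝕜] H, (∀ x y, ⟪Q x, y⟫_𝕜 = ⟪x, Q y⟫_𝕜) ∧
      (∀ x : hA.sqrt.domain, Q (hA.sqrt x) = x) ∧
      (∀ y, ∃ hy : Q y ∈ hA.sqrt.domain, hA.sqrt ⟨Q y, hy⟩ = y) ∧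
      (∀ x : A.domain, Q (A x) = hA.sqrt (hA.incl x)) ∧
      ∀ y, ∃ hy : Q (Q y) ∈ A.domain, A ⟨Q (Q y), hy⟩ = y := by
  obtain ⟨R, hR1, hR2⟩ := hA.invertible
  have hS := hA.isPosSqrt_sqrt
  set S := hA.sqrt with hSdef
  have hsymm : ∀ x y : S.domain, ⟪S x, (y : H)⟫_𝕜 = ⟪(x : H), S y⟫_𝕜 := by
    have h := LinearPMap.adjoint_isFormalAdjoint hS.selfAdjoint.dense_domain
    rw [LinearPMap.isSelfAdjoint_def.1 hS.selfAdjoint] at h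
    exact h
  have hAS : ∀ x : A.domain, ∃ hx : S (hA.incl x) ∈ S.domain, S ⟨S (hA.incl x), hx⟩ = A x := by
    intro x
    obtain ⟨z, hz, hz'⟩ := (hS.sq x (A x)).1 (A.mem_graph x)
    obtain ⟨u, hu, rfl⟩ := (LinearPMap.mem_graph_iff S).1 hz
    obtain ⟨v, hv, hv'⟩ := (LinearPMap.mem_graph_iff S).1 hz'
    obtain rfl : u = hA.incl x := Subtype.ext hu
    have hmem : S (hA.incl x) ∈ S.domain := by
      have h1 : (v : H) = S (hA.incl x) := hv
      rw [← h1]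
      exact v.2
    obtain rfl : v = ⟨S (hA.incl x), hmem⟩ := Subtype.ext hv
    exact ⟨hmem, hv'⟩
  have hSinj : ∀ x : S.domain, S x = 0 → x = 0 := by
    intro x hx
    have h1 : ((x : H), (0 : H)) ∈ A.graph :=
      (hS.sq x 0).2 ⟨0, by rw [← hx]; exact S.mem_graph x, S.graph.zero_mem⟩
    obtain ⟨u, hu, hu'⟩ := (LinearPMap.mem_graph_iff A).1 h1
    have h2 := hR1 u
    rw [hu', map_zero] at h2
    exact Subtype.ext (hu.symm.trans h2.symm)
  let r : H →ₗ[𝕜] A.domain := (R : H →ₗ[𝕜] H).codRestrict A.domain fun y => (hR2 y).1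
  -- `A^{-1/2}` is built as `A^{1/2} A^{-1}`; it is bounded because `‖q y‖² = ⟪R y, y⟫`.
  let q : H →ₗ[𝕜] H := S.toFun ∘ₗ hA.incl ∘ₗ r
  have hAr : ∀ y, A (r y) = y := fun y => (hR2 y).2
  have hqS : ∀ y, ∃ hy : q y ∈ S.domain, S ⟨q y, hy⟩ = y := fun y => by
    obtain ⟨hx, e⟩ := hAS (r y)
    exact ⟨hx, e.trans (hAr y)⟩
  have hbound : ∀ y, ‖q y‖ ≤ √‖R‖ * ‖y‖ := by
    intro y
    obtain ⟨hy, e⟩ := hqS y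
    have h1 : ⟪q y, q y⟫_𝕜 = ⟪R y, y⟫_𝕜 := by
      have h2 := hsymm (hA.incl (r y)) ⟨q y, hy⟩
      rw [e] at h2
      exact h2
    refine le_of_sq_le_sq ?_ (by positivity)
    rw [mul_pow, Real.sq_sqrt (norm_nonneg R), ← inner_self_eq_norm_sq (𝕜 := 𝕜), h1]
    have h3 := re_inner_le_norm (𝕜 := 𝕜) (R y) y
    nlinarith [R.le_opNorm y, norm_nonneg y]
  have hSinj' : ∀ x y : S.domain, S x = S y → x = y := fun x y hxy =>
    sub_eq_zero.1 (hSinj _ (by rw [S.map_sub, hxy, sub_self]))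
  have hqS' : ∀ x : S.domain, q (S x) = x := fun x => by
    obtain ⟨hy, e⟩ := hqS (S x)
    exact congrArg Subtype.val (hSinj' _ _ e)
  have hqA : ∀ x : A.domain, q (A x) = S (hA.incl x) := fun x => by
    obtain ⟨hx, e⟩ := hAS x
    rw [← e, hqS']
  refine ⟨q.mkContinuous _ hbound, fun x y => ?_, hqS', hqS, hqA, fun y => ?_⟩
  · obtain ⟨hx, ex⟩ := hqS x
    obtain ⟨hy, ey⟩ := hqS y
    have h := hsymm ⟨q x, hx⟩ ⟨q y, hy⟩
    rw [ex, ey] at h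
    exact h.symm
  · have h1 : q (q y) = R y := by
      have h2 := hqA (r y)
      rw [hAr] at h2
      have h3 : q y = S (hA.incl (r y)) := rfl
      rw [h3, hqS']
      rfl
    have h2 : q (q y) ∈ A.domain := by
      rw [h1]
      exact (hR2 y).1
    refine ⟨h2, ?_⟩
    obtain ⟨h3, e⟩ := hR2 y
    have h4 : (⟨q (q y), h2⟩ : A.domain) = ⟨R y, h3⟩ := Subtype.ext h1
    exact (congrArg A h4).trans e

end Translation

end WeakStab

/-! ### Return to the unbounded operator `A` -/

theorem mainTheorem4 {𝕜 H U : Type*} [RCLike 𝕜]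
    [NormedAddCommGroup H] [InnerProductSpace 𝕜 H] [CompleteSpace H]
    [NormedSpace ℝ H] [IsScalarTower ℝ 𝕜 H]
    [NormedAddCommGroup U] [InnerProductSpace 𝕜 U] [CompleteSpace U]
    (A : H →ₗ.[𝕜] H) (hA : WeakStab.IsPosInvertible A) (B : U →L[𝕜] H)
    (h : ℝ → ℝ) (h_maps : MapsTo h (Ioi 0) (Ioi 0)) (h_cont : ContinuousOn h (Ioi 0))
    (h_mono : StrictMonoOn h (Ioi 0)) (h_div : MonotoneOn (fun x => h x / x) (Ioo 0 1))
    (T C : ℝ) (hT : 0 < T) (hC : 0 < C) (h_obs : WeakStab.WeakObservability hA B h T C) :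
    ∃ C₁ : ℝ, 0 < C₁ ∧
      ∀ (w₀ : A.domain) (w₁ : hA.sqrt.domain), (w₀, w₁) ≠ 0 →
        ∀ (w : ℝ → A.domain) (w' : ℝ → hA.sqrt.domain),
          WeakStab.IsStrongSolution hA (B ∘L ContinuousLinearMap.adjoint B) w w' w₀ w₁ →
            ∀ t : ℝ, 0 < t → 1 / (1 + t) ∈ h '' Ioi 0 →
              hA.energyNormSq (hA.incl (w t)) (w' t) ≤
                C₁ * Function.invFunOn h (Ioi 0) (1 / (1 + t)) * hA.regularNormSq w₀ w₁ := by
  -- Energy arguments involve only real parts, so the real flow theory covers both scalar fields.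
  -- The given real normed structure is kept, so the derivatives are the same.
  let _ : InnerProductSpace ℝ H := WeakStab.realInnerProductSpace 𝕜 H
  have hinner : ∀ x y : H, ⟪x, y⟫_ℝ = RCLike.re ⟪x, y⟫_𝕜 := fun _ _ => rfl
  obtain ⟨Q, hQ, hQS, hSQ, hQA, hAQ⟩ := hA.exists_sqrt_inverse
  have hQinj : ∀ x, Q x = 0 → x = 0 := fun x hx => by
    obtain ⟨hy, e⟩ := hSQ x
    have h1 : (⟨Q x, hy⟩ : hA.sqrt.domain) = 0 := Subtype.ext hx
    rw [← e, h1, hA.sqrt.map_zero]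
  set D : H →L[𝕜] H := B ∘L ContinuousLinearMap.adjoint B with hD
  have hDinner : ∀ x, RCLike.re ⟪D x, x⟫_𝕜 = ‖ContinuousLinearMap.adjoint B x‖ ^ 2 := fun x => by
    rw [hD, ContinuousLinearMap.comp_apply, ← ContinuousLinearMap.adjoint_inner_right,
      inner_self_eq_norm_sq]
  obtain ⟨C₁, hC₁, hdecay⟩ := WeakStab.exists_decay_constant
    (Q := Q.restrictScalars ℝ) (D := D.restrictScalars ℝ) (κ := ‖B‖ ^ 2)
    (fun x y => by
      rw [hinner, hinner]
      exact congrArg _ (hQ x y))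
    hQinj
    (fun x => by
      rw [hinner]
      exact (hDinner x).symm ▸ sq_nonneg _)
    (sq_nonneg _)
    (fun x => by
      rw [hinner]
      refine le_of_le_of_eq ?_ (congrArg (‖B‖ ^ 2 * ·) (hDinner x).symm)
      change ‖B (ContinuousLinearMap.adjoint B x)‖ ^ 2 ≤ ‖B‖ ^ 2 * _
      rw [← mul_pow]
      gcongr
      exact B.le_opNorm _)
    h_maps h_mono h_div hT hC
    (fun α β hF hpos => by
      -- A pair `(α, β)` comes from the strong solution `φ = Q² α` with velocity `Q β`, to which the
      -- observability hypothesis applies.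
      choose hα eα using fun s => hAQ (α s)
      choose hβ eβ using fun s => hSQ (β s)
      have hval : ∀ s, hA.sqrt (hA.incl ⟨Q (Q (α s)), hα s⟩) = Q (α s) := fun s => by
        rw [← hQA, eα]
      have h1 := h_obs ⟨_, hα 0⟩ ⟨_, hβ 0⟩ (by
        intro h0
        have h2 : (⟨_, hα 0⟩ : A.domain) = 0 := congrArg Prod.fst h0
        have h3 : (⟨_, hβ 0⟩ : hA.sqrt.domain) = 0 := congrArg Prod.snd h0
        have h4 : α 0 = 0 := by rw [← eα 0, h2, A.map_zero]
        have h5 : β 0 = 0 := by rw [← eβ 0, h3, hA.sqrt.map_zero]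
        simp [h4, h5] at hpos)
        (fun s => ⟨_, hα s⟩) (fun s => ⟨_, hβ s⟩)
        { initial_position := rfl
          initial_velocity := rfl
          continuousOn_position := by simpa only [eα] using hF.continuousOn_fst
          continuousOn_velocity := by simpa only [eβ] using hF.continuousOn_snd
          hasDeriv_position := fun s hs => by
            simp only [hval, eβ]
            exact hF.hasDeriv_fst s hs
          equation := fun s hs => by
            refine ⟨_, hF.hasDeriv_snd s hs, ?_⟩
            rw [eα]
            simp }
      simp only [WeakStab.IsPosInvertible.regularNormSq, WeakStab.IsPosInvertible.energyNormSq,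
        hval, eα, eβ] at h1
      refine h1.trans (le_of_eq ?_)
      congr 1
      funext s
      rw [hinner]
      exact (hDinner _).symm)
  refine ⟨C₁, hC₁, fun w₀ w₁ hne w w' hw t ht hrange => ?_⟩
  have hF : WeakStab.IsDampedFlow (Q.restrictScalars ℝ) (D.restrictScalars ℝ)
      (fun s => A (w s)) (fun s => hA.sqrt (w' s)) := by
    refine ⟨hw.continuousOn_position, hw.continuousOn_velocity, fun s hs => ?_, fun s hs => ?_⟩
    · have h1 := hw.hasDeriv_position s hs
      simp only [← hQA] at h1
      exact h1
    · obtain ⟨w'', h1, h2⟩ := hw.equation s hs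
      have h3 : w'' = -A (w s) - D (w' s) := by
        rw [add_assoc] at h2
        rw [eq_neg_of_add_eq_zero_left h2]
        abel
      rw [h3] at h1
      simp only [ContinuousLinearMap.coe_restrictScalars', hQS]
      exact h1
  have hpos : 0 < ‖A (w 0)‖ ^ 2 + ‖hA.sqrt (w' 0)‖ ^ 2 := by
    rw [hw.initial_position, hw.initial_velocity]
    by_contra hneg
    have h1 := sq_nonneg ‖A w₀‖
    have h2 := sq_nonneg ‖hA.sqrt w₁‖
    have h3 : A w₀ = 0 := by
      rw [← norm_eq_zero, ← sq_eq_zero_iff]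
      linarith
    have h4 : hA.sqrt w₁ = 0 := by
      rw [← norm_eq_zero, ← sq_eq_zero_iff]
      linarith
    refine hne (Prod.ext (Subtype.ext ?_) (Subtype.ext ?_))
    · have h5 := hQS (hA.incl w₀)
      rw [← hQA, h3, map_zero, map_zero] at h5
      exact h5.symm
    · have h5 := hQS w₁
      rw [h4, map_zero] at h5
      exact h5.symm
  have hfin := hdecay _ _ hF hpos t ht.le hrange
  simp only [ContinuousLinearMap.coe_restrictScalars', hQS, hQA, hw.initial_position,
    hw.initial_velocity] at hfin
  exact hfin
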